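/- **Setting.** Let $\mathcal D$ be a finite set of designs, partitioned into subsets $\mathcal D_c$, $c\in\mathcal C$ (the designs of context $c$). Let $\Theta\subset\mathbb R\times\mathbb R^k$, let $\nu$ be a measure on $\mathbb R$, and let $\{p(\cdot\mid\theta):\theta\in\Theta\}$ be probability densities with respect to $\nu$ such that, for every $\theta\in\Theta$, almost surely under $p(\cdot\mid\theta)$, $p(y\mid\theta')>0$ for all $\theta'\in\Theta$ (so that log-likelihood ratios are real-valued). Assume: 1. $\Theta$ is compact and its boundary has Lebesgue measure zero; 2. $\theta\mapsto p(y\mid\theta)$ is continuous on $\Theta$ for every $y$; 3. for $\theta\ne\theta'$ in $\Theta$, $\nu\{y:p(y\mid\theta)\ne p(y\mid\theta')\}>0$; 4. for every $\theta\in\Theta$, all $f$ in $\mathcal L=\{\ln (p(\cdot\mid\theta')/p(\cdot\mid\theta'')):\theta',\theta''\in\Theta\}$ are integrable under $p(\cdot\mid\theta)$, and if $Y,Y^{(1)},Y^{(2)},\dots$ are i.i.d. with density $p(\cdot\mid\theta)$, then $\sup_{f\in\mathcal L}\bigl|\frac1T\sum_{t=1}^Tf(Y^{(t)})-\mathbb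 E f(Y)\bigr|\to0$ a.s. Let $\boldsymbol\theta^*=(\theta^*_d)_{d\in\mathcal D}$ be an interior point of $\boldsymbol\Theta=\Theta^{\mathcal D}$, and assume that for each $d\in\mathcal D$ the Kullback–Leibler divergence $\theta\mapsto D(\theta^*_d\|\theta)=\mathbb E_{Y\sim p(\cdot\mid\theta^*_d)}\ln\frac{p(Y\mid\theta^*_d)}{p(Y\mid\theta)}$ is continuously differentiable on $\Theta$. Let $\boldsymbol Y^{(t)}=(Y^{(t)}_d)_{d\in\mathcal D}$, $t\ge1$, be i.i.d. random vectors with independent coordinates $Y_d^{(t)}\sim p(\cdot\mid\theta_d^*)$. At each step $t$ a design $D_t\in\mathcal D$ is chosen and $Y^{(t)}_{D_t}$ is observed. Let $\mathcal E_{t}=\sigma(D_1,Y^{(1)}_{D_1},\dots,D_{t},Y^{(t)}_{D_{t}})$. A sequential sampling policy is a sequence of $\mathcal E_{t-1}$-measurable random probability distributions $\psi_t$ on $\mathcal D$ with $\psi_t(d)=\mathbb P(D_t=d\mid\mathcal E_{t-1})$ a.s., where $\boldsymbol Y^{(t)}$ is independent of $\mathcal E_{t-1}\vee\sigma(D_t)$.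 Put $\bar\psi_T(d)=\frac1T\sum_{t=1}^T\psi_t(d)$, $\bar\alpha_T(c)=\sum_{d\in\mathcal D_c}\bar\psi_T(d)$, $\bar\beta_T(c,d)=\bar\psi_T(d)/\bar\alpha_T(c)$, and $$D_{\bar\psi_T}(\boldsymbol\theta^*\|\boldsymbol\theta)=\sum_{d\in\mathcal D}\bar\psi_T(d)D(\theta_d^*\|\theta_d),\qquad D_{\bar\beta_T(c,\cdot)}(\boldsymbol\theta^*\|\boldsymbol\theta)=\sum_{d\in\mathcal D_c}\bar\beta_T(c,d)D(\theta_d^*\|\theta_d).$$ Let $\Pi_T$ be the posterior distribution on $\boldsymbol\Theta$ for the uniform prior, with density proportional to $\prod_{t=1}^Tp(Y^{(t)}_{D_t}\mid\theta_{D_t})$ with respect to Lebesgue measure. **Theorem.** For any sequential sampling policy: (i) Let $\tilde{\boldsymbol\Theta}\subseteq\boldsymbol\Theta$ be nonempty and relatively open in $\boldsymbol\Theta$, and contained in the closure of the interior of $\boldsymbol\Theta$ (the last condition is automatic if $\tilde{\boldsymbol\Theta}$ is open in the ambient Euclidean space or if $\Theta$ is the closure of its interior). Then almost surely, for all $T$,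 $\Pi_T$ is a well-defined probability measure with $\Pi_T(\tilde{\boldsymbol\Theta})>0$, and $$\lim_{T\to\infty}\Bigl(-\frac1T\ln\Pi_T(\tilde{\boldsymbol\Theta})-\inf_{\boldsymbol\theta\in\tilde{\boldsymbol\Theta}}D_{\bar\psi_T}(\boldsymbol\theta^*\|\boldsymbol\theta)\Bigr)=0.$$ (ii) Let $c\in\mathcal C$ and let $\tilde\Theta_c\subseteq\Theta^{\mathcal D_c}$ be nonempty, relatively open in $\Theta^{\mathcal D_c}$ and contained in the closure of the interior of $\Theta^{\mathcal D_c}$, and put $\tilde{\boldsymbol\Theta}=\{\boldsymbol\theta\in\boldsymbol\Theta:(\theta_d)_{d\in\mathcal D_c}\in\tilde\Theta_c\}$. Then with probability one, if $T\bar\alpha_T(c)\to\infty$, then $\Pi_T(\tilde{\boldsymbol\Theta})>0$ for all $T$ and $$\lim_{T\to\infty}\Bigl(-\frac1{T\bar\alpha_T(c)}\ln\Pi_T(\tilde{\boldsymbol\Theta})-\inf_{\boldsymbol\theta\in\tilde{\boldsymbol\Theta}}D_{\bar\beta_T(c,\cdot)}(\boldsymbol\theta^*\|\boldsymbol\theta)\Bigr)=0.$$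 -/

import Mathlib

open MeasureTheory ProbabilityTheory Filter Topology Set
open scoped ENNReal

noncomputable section

namespace ContextualSelection

/-- A parameter `θ = (μ, η)`: a real parameter of interest and a nuisance parameter in `ℝ^k`. -/
abbrev Param (k : ℕ) : Type := ℝ × EuclideanSpace ℝ (Fin k)

variable {k : ℕ} {𝓓 : Type*} {Ω : Type*}

/-- The sampling distribution with density `p θ` with respect to the base measure `ν`. -/
def law (ν : Measure ℝ) (p : Param k → ℝ → ℝ) (θ : Param k) : Measure ℝ :=
  ν.withDensity (fun y => ENNReal.ofReal (p θ y))

/-- The log-likelihood ratio `ln (p(y|θ') / p(y|θ''))`. -/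
def logLR (p : Param k → ℝ → ℝ) (θ' θ'' : Param k) (y : ℝ) : ℝ :=
  Real.log (p θ' y / p θ'' y)

/-- `p θ`, `θ ∈ Θ`, is a family of probability densities, and the log-likelihood ratios of its
members are almost surely well-defined real numbers under every member. -/
structure IsDensityFamily (ν : Measure ℝ) (p : Param k → ℝ → ℝ) (Θ : Set (Param k)) : Prop where
  measurable : ∀ θ ∈ Θ, Measurable (p θ)
  nonneg : ∀ θ ∈ Θ, ∀ y, 0 ≤ p θ y
  lintegral_eq_one : ∀ θ ∈ Θ, ∫⁻ y, ENNReal.ofReal (p θ y) ∂ν = 1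
  ae_pos : ∀ θ ∈ Θ, ∀ᵐ y ∂(law ν p θ), ∀ θ' ∈ Θ, 0 < p θ' y

/-- The log-likelihood ratios form a universal Glivenko-Cantelli class: for every `θ ∈ Θ` they are
integrable under `law ν p θ`, and for an i.i.d. sequence with that law their empirical means
converge to their expectations almost surely, uniformly over the class. -/
def IsUniversalGC (ν : Measure ℝ) (p : Param k → ℝ → ℝ) (Θ : Set (Param k)) : Prop :=
  ∀ θ ∈ Θ,
    (∀ θ' ∈ Θ, ∀ θ'' ∈ Θ, Integrable (logLR p θ' θ'') (law ν p θ)) ∧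
    ∀ᵐ y ∂(Measure.infinitePi (fun _ : ℕ => law ν p θ)),
      TendstoUniformlyOn
        (fun (T : ℕ) (q : Param k × Param k) =>
          (1 / (T : ℝ)) * ∑ t ∈ Finset.range T, logLR p q.1 q.2 (y t))
        (fun q : Param k × Param k => ∫ z, logLR p q.1 q.2 z ∂(law ν p θ))
        atTop (Θ ×ˢ Θ)

/-- The regularity conditions on the parametric family. -/
structure IsRegularFamily (ν : Measure ℝ) (p : Param k → ℝ → ℝ) (Θ : Set (Param k)) : Prop where
  density : IsDensityFamily ν p Θ
  compact : IsCompact Θ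
  boundary_null : volume (frontier Θ) = 0
  continuous : ∀ y, ContinuousOn (fun θ => p θ y) Θ
  identifiable : ∀ θ ∈ Θ, ∀ θ' ∈ Θ, θ ≠ θ' → 0 < ν {y | p θ y ≠ p θ' y}
  glivenkoCantelli : IsUniversalGC ν p Θ

/-- The Kullback-Leibler divergence `D(θ₀ ‖ θ) = 𝔼_{Y ∼ p(·|θ₀)} [ln (p(Y|θ₀) / p(Y|θ))]`. -/
def KL (ν : Measure ℝ) (p : Param k → ℝ → ℝ) (θ₀ θ : Param k) : ℝ :=
  ∫ y, logLR p θ₀ θ y ∂(law ν p θ₀)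

/-- The full parameter space `Θ^I` for a set `I` of designs. -/
def paramSpace (I : Type*) (Θ : Set (Param k)) : Set (I → Param k) :=
  Set.univ.pi (fun _ => Θ)

/-- `S` is a nonempty relatively open subset of `B` which lies in the closure of the interior
of `B` (the latter is automatic when `S` is open in the ambient space, and when `B` is the closure
of its interior). -/
structure IsAdmissibleOpen {X : Type*} [TopologicalSpace X] (B S : Set X) : Prop where
  relOpen : ∃ U : Set X, IsOpen U ∧ S = U ∩ B
  subset_closure : S ⊆ closure (interior B)
  nonempty : S.Nonempty

/-- The information available before step `t` (steps are numbered from `0`): the sigma-algebra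
generated by the designs `A s` chosen and the outcomes `Y s (A s)` observed at steps `s < t`. -/
@[reducible] def observed [MeasurableSpace 𝓓] (Y : ℕ → Ω → 𝓓 → ℝ) (A : ℕ → Ω → 𝓓) (t : ℕ) :
    MeasurableSpace Ω :=
  ⨆ s ∈ Finset.range t,
    MeasurableSpace.comap (fun ω => (A s ω, Y s ω (A s ω))) inferInstance

/-- `Y t` are independent replications of the vector of all outcomes, with independent coordinates
`Y t · d` of law `p(·|θ*_d)`; at step `t` the design `A t` is drawn from the distribution `ψ t`
on designs, which is determined by the observed information, by means of a source of randomness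
that does not anticipate `Y t`. -/
structure IsSequentialSampling [Fintype 𝓓] [DecidableEq 𝓓] [MeasurableSpace 𝓓]
    [MeasurableSpace Ω] (P : Measure Ω) (ν : Measure ℝ) (p : Param k → ℝ → ℝ)
    (θstar : 𝓓 → Param k) (Y : ℕ → Ω → 𝓓 → ℝ) (A : ℕ → Ω → 𝓓) (ψ : ℕ → 𝓓 → Ω → ℝ) : Prop where
  measurable_Y : ∀ t, Measurable (Y t)
  measurable_A : ∀ t, Measurable (A t)
  map_Y : ∀ t, P.map (Y t) = Measure.pi (fun d => law ν p (θstar d))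
  iIndep_Y : iIndepFun Y P
  adapted : ∀ t d, Measurable[observed Y A t] (ψ t d)
  nonneg : ∀ t d ω, 0 ≤ ψ t d ω
  sum_eq_one : ∀ t ω, ∑ d, ψ t d ω = 1
  condProb : ∀ t d,
    P[fun ω => if A t ω = d then (1 : ℝ) else 0 | observed Y A t] =ᵐ[P] ψ t d
  nonanticipating : ∀ t,
    Indep (MeasurableSpace.comap (Y t) inferInstance)
      (observed Y A t ⊔ MeasurableSpace.comap (A t) inferInstance) P

/-- The likelihood of the first `T` observations. -/
def likelihood (p : Param k → ℝ → ℝ) (Y : ℕ → Ω → 𝓓 → ℝ) (A : ℕ → Ω → 𝓓) (T : ℕ) (ω : Ω)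
    (θ : 𝓓 → Param k) : ℝ≥0∞ :=
  ∏ t ∈ Finset.range T, ENNReal.ofReal (p (θ (A t ω)) (Y t ω (A t ω)))

/-- The posterior distribution after `T` observations, for the uniform prior on `Θ^𝓓`. -/
def posteriorMeasure [Fintype 𝓓] (p : Param k → ℝ → ℝ) (Θ : Set (Param k)) (Y : ℕ → Ω → 𝓓 → ℝ)
    (A : ℕ → Ω → 𝓓) (T : ℕ) (ω : Ω) : Measure (𝓓 → Param k) :=
  (∫⁻ θ in paramSpace 𝓓 Θ, likelihood p Y A T ω θ)⁻¹ •
    (volume.restrict (paramSpace 𝓓 Θ)).withDensity (likelihood p Y A T ω)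

/-- `ψ̄_T(d)`, the average sampling ratio of design `d`. -/
def psiBar (ψ : ℕ → 𝓓 → Ω → ℝ) (T : ℕ) (d : 𝓓) (ω : Ω) : ℝ :=
  (∑ t ∈ Finset.range T, ψ t d ω) / T

/-- `ᾱ_T(c)`, the average sampling ratio of context `c`; `ctx d` is the context of `d`. -/
def alphaBar [Fintype 𝓓] {𝓒 : Type*} [DecidableEq 𝓒] (ctx : 𝓓 → 𝓒) (ψ : ℕ → 𝓓 → Ω → ℝ)
    (T : ℕ) (c : 𝓒) (ω : Ω) : ℝ :=
  ∑ d with ctx d = c, psiBar ψ T d ω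

/-- `β̄_T(c, d)`, the conditional sampling ratio of design `d` within context `c`. -/
def betaBar [Fintype 𝓓] {𝓒 : Type*} [DecidableEq 𝓒] (ctx : 𝓓 → 𝓒) (ψ : ℕ → 𝓓 → Ω → ℝ)
    (T : ℕ) (c : 𝓒) (d : 𝓓) (ω : Ω) : ℝ :=
  psiBar ψ T d ω / alphaBar ctx ψ T c ω

/-- The weighted KL divergence `∑_{d ∈ I} w_d D(θ*_d ‖ θ_d)`. -/
def weightedKL (ν : Measure ℝ) (p : Param k → ℝ → ℝ) (I : Finset 𝓓) (w : 𝓓 → ℝ)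
    (θstar θ : 𝓓 → Param k) : ℝ :=
  ∑ d ∈ I, w d * KL ν p (θstar d) (θ d)

/-- The set of parameter vectors in `Θ^𝓓` whose coordinates in context `c` form a vector in `S`. -/
def contextCylinder {𝓒 : Type*} (ctx : 𝓓 → 𝓒) (Θ : Set (Param k)) (c : 𝓒)
    (S : Set ({d : 𝓓 // ctx d = c} → Param k)) : Set (𝓓 → Param k) :=
  {θ | θ ∈ paramSpace 𝓓 Θ ∧ (fun d : {d : 𝓓 // ctx d = c} => θ d) ∈ S}

end ContextualSelection

end

open ContextualSelection

/-!
The likelihood is a product over designs, and the factor of design `d` after `T` steps is, up to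
a constant, `exp (-L_T(θ_d))`, where `L_T` is the log-likelihood ratio of `θ*_d` against `θ_d` in the
outcomes observed from `d`. The theorem rests on one uniform estimate. Writing
`Ψ_T(d) = ∑_{t < T} ψ_t(d)`, almost surely, for every `ε > 0` there is a `C` such that eventually

`|L_T(x) - Ψ_T(d) * KL(θ*_d, x)| ≤ ε * Ψ_T(d) + C` for all `x ∈ Θ`

(`IsSequentialSampling.ae_abs_designLogLR_sub_le`). No case distinction between designs sampled
finitely and infinitely often is needed after that. The estimate has two ingredients.

* *Optional skipping* (`ae_of_ae_infinitePi`). The outcomes observed from a design, if infinite in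
  number, have every almost sure property of an i.i.d. sequence, in particular the uniform law
  of large numbers. Since the number of observations may be finite, the sequence is continued by
  an independent i.i.d. sequence on a product space; the continued sequence is then exactly i.i.d.,
  which is checked on boxes.
* *Compensators* (`ae_abs_sum_sub_compensator_le`). With `N_T` the number of observations from
  the design, `exp (l * N_T - (exp l - 1) * Ψ_T)` is a nonnegative supermartingale for every real
  `l`, so almost surely it converges and its exponent is bounded above. Small `l` of either sign give
  `|N_T - Ψ_T| ≤ ε * Ψ_T + C`.

The rest is Laplace's method on the compact set `Θ^I` (`LaplaceData.tendsto_log_div`,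
`tendsto_log_setLIntegral_prod_div`), for a rate function which varies with `T` but stays
in a uniformly equicontinuous family, the weights `Ψ_T(d) / ∑ Ψ_T` being at most one. The integral over
an admissible set `S` is bounded below because the parts of `S` in balls of a fixed radius around its
points have measure bounded below. The normalizing integral decays at rate zero, by Gibbs' inequality
and because the divergences vanish at the interior point `θ*`.

Part (i) is the case `I = 𝓓`, where `∑ Ψ_T = T`. In part (ii), the factors of the designs outside
the context cancel in the posterior probability of a cylinder, and `I` is the set of designs of the
context.
-/

namespace ContextualSelection

/-! ### Laplace asymptotics on a compact set -/

theorem IsAdmissibleOpen.subset {X : Type*} [TopologicalSpace X] {B S : Set X}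
    (hS : IsAdmissibleOpen B S) : S ⊆ B := by
  obtain ⟨U, -, rfl⟩ := hS.relOpen
  exact inter_subset_right

theorem IsAdmissibleOpen.measurableSet {X : Type*} [TopologicalSpace X] [MeasurableSpace X]
    [OpensMeasurableSpace X] {B S : Set X} (hS : IsAdmissibleOpen B S) (hB : MeasurableSet B) :
    MeasurableSet S := by
  obtain ⟨U, hU, rfl⟩ := hS.relOpen
  exact hU.measurableSet.inter hB

/-- Every point of an admissible set has neighbourhoods meeting the set in positive measure:
arbitrarily close to the point there are interior points of `B`. -/
theorem IsAdmissibleOpen.measure_inter_pos {X : Type*} [TopologicalSpace X] [MeasurableSpace X]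
    {μ : Measure X} [μ.IsOpenPosMeasure] {B S : Set X} (hS : IsAdmissibleOpen B S)
    {x : X} (hx : x ∈ S) {V : Set X} (hV : IsOpen V) (hxV : x ∈ V) : 0 < μ (S ∩ V) := by
  obtain ⟨U, hU, rfl⟩ := hS.relOpen
  have hne : (U ∩ V ∩ interior B).Nonempty :=
    mem_closure_iff.1 (hS.subset_closure hx) _ (hU.inter hV) ⟨hx.1, hxV⟩
  refine (((hU.inter hV).inter isOpen_interior).measure_pos μ hne).trans_le (measure_mono ?_)
  rintro y ⟨⟨h1, h2⟩, h3⟩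
  exact ⟨⟨h1, interior_subset h3⟩, h2⟩

theorem isAdmissibleOpen_interior {X : Type*} [TopologicalSpace X] {B : Set X}
    (hB : (interior B).Nonempty) : IsAdmissibleOpen B (interior B) :=
  ⟨⟨interior B, isOpen_interior, (inter_eq_left.2 interior_subset).symm⟩, subset_closure, hB⟩

/-- In an admissible set, the measure of the part within distance `δ` of a point is bounded below,
uniformly over the points. -/
theorem IsAdmissibleOpen.exists_measure_ball_ge {X : Type*} [MetricSpace X]
    [MeasurableSpace X] {μ : Measure X} [μ.IsOpenPosMeasure] {B S : Set X}
    (hS : IsAdmissibleOpen B S) (hB : IsCompact B) {δ : ℝ} (hδ : 0 < δ) :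
    ∃ v : ℝ, 0 < v ∧ ∀ x ∈ S, ENNReal.ofReal v ≤ μ (S ∩ Metric.ball x δ) := by
  obtain ⟨t, htS, htfin, hcov⟩ := Metric.finite_approx_of_totallyBounded
    (hB.totallyBounded.subset hS.subset) (δ / 2) (half_pos hδ)
  have hpos : ∀ y ∈ t, ∃ v : ℝ, 0 < v ∧ ENNReal.ofReal v ≤ μ (S ∩ Metric.ball y (δ / 2)) := by
    intro y hy
    have h := hS.measure_inter_pos (μ := μ) (htS hy) Metric.isOpen_ball
      (Metric.mem_ball_self (half_pos hδ))
    obtain ⟨r, hr0, hr⟩ := ENNReal.lt_iff_exists_nnreal_btwn.1 h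
    exact ⟨r, by exact_mod_cast hr0, by simpa using hr.le⟩
  choose! w hw0 hw using hpos
  have htne : htfin.toFinset.Nonempty := by
    obtain ⟨x, hx⟩ := hS.nonempty
    obtain ⟨y, hy, -⟩ := mem_iUnion₂.1 (hcov hx)
    exact ⟨y, by simpa using hy⟩
  refine ⟨htfin.toFinset.inf' htne w, ?_, fun x hx => ?_⟩
  · rw [Finset.lt_inf'_iff]
    intro y hy
    exact hw0 y (by simpa using hy)
  · obtain ⟨y, hy, hxy⟩ := mem_iUnion₂.1 (hcov hx)
    calc ENNReal.ofReal (htfin.toFinset.inf' htne w) ≤ ENNReal.ofReal (w y) :=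
          ENNReal.ofReal_le_ofReal (Finset.inf'_le _ (by simpa using hy))
      _ ≤ μ (S ∩ Metric.ball y (δ / 2)) := hw y hy
      _ ≤ μ (S ∩ Metric.ball x δ) := by
          refine measure_mono (inter_subset_inter_right _ ?_)
          refine Metric.ball_subset_ball' ?_
          have := Metric.mem_ball'.1 hxy
          linarith

/-- The rates `D n`, the speeds `M n` and the integrands `f n` of a Laplace integral over a compact
set `B`: up to a constant factor `c n`, `f n` is `exp (-h n)`, where `h n = M n * D n + o(M n)`
uniformly on `B`. -/
structure LaplaceData {X : Type*} [MetricSpace X] (B : Set X) (D : ℕ → X → ℝ) (M : ℕ → ℝ)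
    (f : ℕ → X → ℝ≥0∞) (c : ℕ → ℝ≥0∞) (h : ℕ → X → ℝ) : Prop where
  compact : IsCompact B
  rate_nonneg : ∀ n, ∀ x ∈ B, 0 ≤ D n x
  equicontinuous : ∀ ε > 0, ∃ δ > 0, ∀ n, ∀ x ∈ B, ∀ y ∈ B, dist x y < δ → |D n x - D n y| ≤ ε
  tendsto_speed : Tendsto M atTop atTop
  const_ne_zero : ∀ n, c n ≠ 0
  const_ne_top : ∀ n, c n ≠ ∞
  eq_exp : ∀ n, ∀ x ∈ B, f n x = c n * ENNReal.ofReal (Real.exp (-h n x))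
  approx : ∀ ε > 0, ∀ᶠ n in atTop, ∀ x ∈ B, |h n x - M n * D n x| ≤ ε * M n

namespace LaplaceData

variable {X : Type*} [MetricSpace X] {B S : Set X} {D : ℕ → X → ℝ} {M : ℕ → ℝ}
  {f : ℕ → X → ℝ≥0∞} {c : ℕ → ℝ≥0∞} {h : ℕ → X → ℝ}

theorem bddBelow (H : LaplaceData B D M f c h) (hSB : S ⊆ B) (n : ℕ) : BddBelow (D n '' S) :=
  ⟨0, by rintro _ ⟨x, hx, rfl⟩; exact H.rate_nonneg n x (hSB hx)⟩

theorem setLIntegral_le [MeasurableSpace X] [OpensMeasurableSpace X] (H : LaplaceData B D M f c h)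
    {μ : Measure X} [IsFiniteMeasureOnCompacts μ] (hSB : S ⊆ B) (hSm : MeasurableSet S) {ε : ℝ}
    (hε : 0 < ε) :
    ∀ᶠ n in atTop, ∫⁻ x in S, f n x ∂μ ≤
      c n * ENNReal.ofReal (Real.exp (-(M n * (sInf (D n '' S) - ε))) * (μ B).toReal) := by
  filter_upwards [H.approx ε hε, H.tendsto_speed.eventually_ge_atTop 0] with n hn hM
  calc ∫⁻ x in S, f n x ∂μ
      ≤ ∫⁻ x in S, c n * ENNReal.ofReal (Real.exp (-(M n * (sInf (D n '' S) - ε)))) ∂μ := by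
        refine setLIntegral_mono' hSm fun x hx => ?_
        rw [H.eq_exp n x (hSB hx)]
        gcongr
        have h1 := abs_le.1 (hn x (hSB hx))
        have h2 : sInf (D n '' S) ≤ D n x := csInf_le (H.bddBelow hSB n) ⟨x, hx, rfl⟩
        nlinarith [mul_le_mul_of_nonneg_left h2 hM]
    _ = c n * ENNReal.ofReal (Real.exp (-(M n * (sInf (D n '' S) - ε)))) * μ S := by
        rw [setLIntegral_const]
    _ ≤ c n * ENNReal.ofReal (Real.exp (-(M n * (sInf (D n '' S) - ε)))) * μ B := by gcongr
    _ = _ := by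
        rw [ENNReal.ofReal_mul (Real.exp_nonneg _), ENNReal.ofReal_toReal
          H.compact.measure_lt_top.ne, mul_assoc]

theorem le_setLIntegral [MeasurableSpace X] [OpensMeasurableSpace X] (H : LaplaceData B D M f c h)
    {μ : Measure X} [μ.IsOpenPosMeasure] (hS : IsAdmissibleOpen B S) {ε : ℝ} (hε : 0 < ε) :
    ∃ v : ℝ, 0 < v ∧ ∀ᶠ n in atTop,
      c n * ENNReal.ofReal (Real.exp (-(M n * (sInf (D n '' S) + ε))) * v) ≤
        ∫⁻ x in S, f n x ∂μ := by
  have hε3 : 0 < ε / 3 := by positivity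
  obtain ⟨δ, hδ, hδD⟩ := H.equicontinuous (ε / 3) hε3
  obtain ⟨v, hv, hvS⟩ := hS.exists_measure_ball_ge (μ := μ) H.compact hδ
  refine ⟨v, hv, ?_⟩
  filter_upwards [H.approx (ε / 3) hε3, H.tendsto_speed.eventually_ge_atTop 0] with n hn hM
  obtain ⟨_, ⟨x, hx, rfl⟩, hxlt⟩ := exists_lt_of_csInf_lt (hS.nonempty.image (D n))
    (lt_add_of_pos_right (sInf (D n '' S)) hε3)
  have hm : MeasurableSet (S ∩ Metric.ball x δ) :=
    (hS.measurableSet H.compact.measurableSet).inter Metric.isOpen_ball.measurableSet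
  calc c n * ENNReal.ofReal (Real.exp (-(M n * (sInf (D n '' S) + ε))) * v)
      = c n * ENNReal.ofReal (Real.exp (-(M n * (sInf (D n '' S) + ε)))) * ENNReal.ofReal v := by
        rw [ENNReal.ofReal_mul (Real.exp_nonneg _), mul_assoc]
    _ ≤ c n * ENNReal.ofReal (Real.exp (-(M n * (sInf (D n '' S) + ε)))) *
          μ (S ∩ Metric.ball x δ) := by gcongr; exact hvS x hx
    _ = ∫⁻ y in S ∩ Metric.ball x δ,
          c n * ENNReal.ofReal (Real.exp (-(M n * (sInf (D n '' S) + ε)))) ∂μ := by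
        rw [setLIntegral_const]
    _ ≤ ∫⁻ y in S ∩ Metric.ball x δ, f n y ∂μ := by
        refine setLIntegral_mono' hm fun y hy => ?_
        rw [H.eq_exp n y (hS.subset hy.1)]
        gcongr
        have h1 := abs_le.1 (hn y (hS.subset hy.1))
        have h2 := abs_le.1 (hδD n y (hS.subset hy.1) x (hS.subset hx) hy.2)
        have h3 : D n y ≤ sInf (D n '' S) + 2 * (ε / 3) := by linarith
        nlinarith [mul_le_mul_of_nonneg_left h3 hM]
    _ ≤ ∫⁻ y in S, f n y ∂μ := lintegral_mono_set inter_subset_left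

/-- Laplace's principle, with a rate that varies with `n`: the proportion of the integral of `f n`
over `B` which comes from `S` decays at the exponential rate `inf_S D n`, if `D n` vanishes at
an interior point of `B`. -/
theorem tendsto_log_div [MeasurableSpace X] [OpensMeasurableSpace X] (H : LaplaceData B D M f c h)
    {μ : Measure X} [μ.IsOpenPosMeasure] [IsFiniteMeasureOnCompacts μ]
    (hS : IsAdmissibleOpen B S) {x₀ : X} (hx₀ : x₀ ∈ interior B) (hD₀ : ∀ n, D n x₀ = 0) :
    Tendsto (fun n => -(1 / M n) *
        Real.log ((∫⁻ x in S, f n x ∂μ) / ∫⁻ x in B, f n x ∂μ).toReal - sInf (D n '' S))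
      atTop (𝓝 0) := by
  have hV : 0 < (μ B).toReal := by
    refine ENNReal.toReal_pos ?_ H.compact.measure_lt_top.ne
    exact ((isOpen_interior.measure_pos μ ⟨x₀, hx₀⟩).trans_le (measure_mono interior_subset)).ne'
  set V := (μ B).toReal
  have hinfB : ∀ T : Set X, T ⊆ B → x₀ ∈ T → ∀ n, sInf (D n '' T) = 0 := by
    intro T hT hxT n
    refine le_antisymm ((csInf_le (H.bddBelow hT n) ⟨x₀, hxT, rfl⟩).trans (hD₀ n).le) ?_
    refine le_csInf ⟨_, x₀, hxT, rfl⟩ ?_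
    rintro _ ⟨x, hx, rfl⟩
    exact H.rate_nonneg n x (hT hx)
  rw [Metric.tendsto_nhds]
  intro ε hε
  have hε4 : 0 < ε / 4 := by positivity
  obtain ⟨v, hv, hlow⟩ := H.le_setLIntegral (μ := μ) hS hε4
  obtain ⟨v', hv', hlow'⟩ :=
    H.le_setLIntegral (μ := μ) (isAdmissibleOpen_interior ⟨x₀, hx₀⟩) hε4
  have hlog : ∀ C : ℝ, ∀ᶠ n in atTop, |Real.log C / M n| < ε / 4 := by
    intro C
    have := (H.tendsto_speed.const_div_atTop (Real.log C)).abs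
    simp only [abs_zero] at this
    exact this.eventually_lt_const hε4
  filter_upwards [hlow, hlow', H.setLIntegral_le (μ := μ) hS.subset
      (hS.measurableSet H.compact.measurableSet) hε4,
    H.setLIntegral_le (μ := μ) subset_rfl H.compact.measurableSet hε4,
    H.tendsto_speed.eventually_gt_atTop 0, hlog (v / V), hlog (V / v')]
    with n h1 h2 h3 h4 hM hl1 hl2
  rw [hinfB _ subset_rfl (interior_subset hx₀) n] at h4
  rw [hinfB _ interior_subset hx₀ n] at h2
  replace h2 := h2.trans (lintegral_mono_set interior_subset)
  set m := sInf (D n '' S)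
  set N := ∫⁻ x in S, f n x ∂μ
  set Z := ∫⁻ x in B, f n x ∂μ
  have hc0 := H.const_ne_zero n
  have hct := H.const_ne_top n
  have hquot : ∀ a b : ℝ, 0 < b →
      c n * ENNReal.ofReal a / (c n * ENNReal.ofReal b) = ENNReal.ofReal (a / b) := by
    intro a b hb
    rw [ENNReal.mul_div_mul_left _ _ hc0 hct, ENNReal.ofReal_div_of_pos hb]
  have hup : N / Z ≤ ENNReal.ofReal (Real.exp (-(M n * (m - ε / 4))) * V /
      (Real.exp (-(M n * (0 + ε / 4))) * v')) := by
    rw [← hquot _ _ (by positivity)]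
    exact ENNReal.div_le_div h3 h2
  have hdown : ENNReal.ofReal (Real.exp (-(M n * (m + ε / 4))) * v /
      (Real.exp (-(M n * (0 - ε / 4))) * V)) ≤ N / Z := by
    rw [← hquot _ _ (by positivity)]
    exact ENNReal.div_le_div h1 h4
  have hfin : N / Z ≠ ∞ := ne_top_of_le_ne_top ENNReal.ofReal_ne_top hup
  have hup' := ENNReal.toReal_mono ENNReal.ofReal_ne_top hup
  have hdown' := ENNReal.toReal_mono hfin hdown
  rw [ENNReal.toReal_ofReal (by positivity)] at hup' hdown'
  have hr : 0 < (N / Z).toReal := lt_of_lt_of_le (by positivity) hdown'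
  have e1 := Real.log_le_log hr hup'
  have e2 := Real.log_le_log (by positivity) hdown'
  rw [mul_div_mul_comm, ← Real.exp_sub, Real.log_mul (Real.exp_ne_zero _) (by positivity),
    Real.log_exp] at e1 e2
  rw [Real.dist_eq, sub_zero]
  set L := Real.log (N / Z).toReal
  have hL : -(1 / M n) * L - m = (-L - M n * m) / M n := by field_simp
  rw [abs_div, abs_of_pos hM, div_lt_iff₀ hM] at hl1 hl2
  rw [hL, abs_div, abs_of_pos hM, div_lt_iff₀ hM]
  rw [abs_lt] at *
  constructor <;> nlinarith

end LaplaceData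

/-! ### Counting processes and their compensators -/

section Compensator

variable {Ω : Type*} {mΩ : MeasurableSpace Ω} {P : Measure Ω} [IsProbabilityMeasure P]
  {ℱ : Filtration ℕ mΩ} {X ψ : ℕ → Ω → ℝ}

theorem supermartingale_exp_compensated (hX : ∀ t, StronglyMeasurable[ℱ (t + 1)] (X t))
    (hX01 : ∀ t ω, X t ω = 0 ∨ X t ω = 1) (hψ : ∀ t, StronglyMeasurable[ℱ t] (ψ t))
    (hψ0 : ∀ t ω, 0 ≤ ψ t ω) (hψ1 : ∀ t ω, ψ t ω ≤ 1) (hc : ∀ t, P[X t | ℱ t] =ᵐ[P] ψ t) (l : ℝ) :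
    Supermartingale (fun T ω => Real.exp (l * ∑ t ∈ Finset.range T, X t ω -
      (Real.exp l - 1) * ∑ t ∈ Finset.range T, ψ t ω)) ℱ P := by
  set a := Real.exp l - 1 with ha
  set W : ℕ → Ω → ℝ := fun T ω => Real.exp (l * ∑ t ∈ Finset.range T, X t ω -
      a * ∑ t ∈ Finset.range T, ψ t ω) with hW
  have hXm : ∀ T, ∀ t ∈ Finset.range T, StronglyMeasurable[ℱ T] (X t) := fun T t ht =>
    (hX t).mono (ℱ.mono (Finset.mem_range.1 ht))
  have hψm : ∀ T, ∀ t ∈ Finset.range T, StronglyMeasurable[ℱ T] (ψ t) := fun T t ht =>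
    (hψ t).mono (ℱ.mono (Finset.mem_range.1 ht).le)
  have hWm : ∀ T, StronglyMeasurable[ℱ T] (W T) := by
    intro T
    refine Real.continuous_exp.comp_stronglyMeasurable ?_
    exact ((Finset.stronglyMeasurable_fun_sum _ (hXm T)).const_mul l).sub
      ((Finset.stronglyMeasurable_fun_sum _ (hψm T)).const_mul a)
  have hsum : ∀ (u : ℕ → Ω → ℝ), (∀ t ω, 0 ≤ u t ω) → (∀ t ω, u t ω ≤ 1) → ∀ (T : ℕ) (ω : Ω),
      |∑ t ∈ Finset.range T, u t ω| ≤ T := by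
    intro u h0 h1 T ω
    rw [abs_of_nonneg (Finset.sum_nonneg fun t _ => h0 t ω)]
    calc ∑ t ∈ Finset.range T, u t ω ≤ ∑ t ∈ Finset.range T, (1 : ℝ) :=
          Finset.sum_le_sum fun t _ => h1 t ω
      _ = T := by simp
  have hX0 : ∀ t ω, 0 ≤ X t ω := fun t ω => by rcases hX01 t ω with h | h <;> simp [h]
  have hX1 : ∀ t ω, X t ω ≤ 1 := fun t ω => by rcases hX01 t ω with h | h <;> simp [h]
  have hWb : ∀ T ω, W T ω ≤ Real.exp (|l| * T + |a| * T) := by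
    intro T ω
    refine Real.exp_le_exp.2 ?_
    refine (le_abs_self _).trans ((abs_sub _ _).trans ?_)
    rw [abs_mul, abs_mul]
    gcongr
    · exact hsum X hX0 hX1 T ω
    · exact hsum ψ hψ0 hψ1 T ω
  have hWi : ∀ T, Integrable (W T) P := by
    intro T
    refine Integrable.of_bound ((hWm T).mono (ℱ.le T)).aestronglyMeasurable
      (Real.exp (|l| * T + |a| * T)) (Eventually.of_forall fun ω => ?_)
    rw [Real.norm_eq_abs, abs_of_pos (Real.exp_pos _)]
    exact hWb T ω
  refine supermartingale_nat hWm hWi fun T => ?_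
  set G : Ω → ℝ := fun ω => W T ω * Real.exp (-(a * ψ T ω)) with hG
  have hGm : StronglyMeasurable[ℱ T] G :=
    (hWm T).mul (Real.continuous_exp.comp_stronglyMeasurable ((hψ T).const_mul a).neg)
  have hGi : Integrable G P := by
    refine (hWi T).mul_bdd (c := Real.exp |a|)
      (Real.continuous_exp.comp_stronglyMeasurable
        ((hψ T).const_mul a).neg |>.mono (ℱ.le T)).aestronglyMeasurable
      (Eventually.of_forall fun ω => ?_)
    rw [Real.norm_eq_abs, abs_of_pos (Real.exp_pos _)]
    refine Real.exp_le_exp.2 ((neg_le_abs _).trans ?_)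
    rw [abs_mul, abs_of_nonneg (hψ0 T ω)]
    exact mul_le_of_le_one_right (abs_nonneg _) (hψ1 T ω)
  have hXTm : AEStronglyMeasurable (X T) P := ((hX T).mono (ℱ.le _)).aestronglyMeasurable
  have hXi : Integrable (X T) P := by
    refine Integrable.of_bound hXTm 1 (Eventually.of_forall fun ω => ?_)
    rw [Real.norm_eq_abs, abs_of_nonneg (hX0 T ω)]
    exact hX1 T ω
  have haGX : Integrable ((fun ω => a * G ω) * X T) P := by
    refine (hGi.const_mul a).mul_bdd (c := 1) hXTm (Eventually.of_forall fun ω => ?_)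
    rw [Real.norm_eq_abs, abs_of_nonneg (hX0 T ω)]
    exact hX1 T ω
  -- since `X T` is `0` or `1`, `exp (l * X T) = 1 + (exp l - 1) * X T`
  have hstep : W (T + 1) = G + (fun ω => a * G ω) * X T := by
    funext ω
    simp only [hW, hG, Pi.add_apply, Pi.mul_apply, Finset.sum_range_succ]
    rw [show l * (∑ t ∈ Finset.range T, X t ω + X T ω) - a * (∑ t ∈ Finset.range T, ψ t ω + ψ T ω) =
      (l * ∑ t ∈ Finset.range T, X t ω - a * ∑ t ∈ Finset.range T, ψ t ω) + -(a * ψ T ω) +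
        l * X T ω by ring, Real.exp_add, Real.exp_add]
    rcases hX01 T ω with h | h <;> rw [h]
    · simp
    · simp only [mul_one, ha]; ring
  have hcond : P[W (T + 1) | ℱ T] =ᵐ[P] G + (fun ω => a * G ω) * ψ T := by
    rw [hstep]
    refine (condExp_add hGi haGX _).trans ?_
    rw [condExp_of_stronglyMeasurable (ℱ.le T) hGm hGi]
    refine EventuallyEq.add (EventuallyEq.refl _ _) ?_
    refine (condExp_mul_of_stronglyMeasurable_left (hGm.const_mul a) haGX hXi).trans ?_
    exact (EventuallyEq.refl _ _).mul (hc T)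
  filter_upwards [hcond] with ω hω
  rw [hω]
  simp only [hG, Pi.add_apply, Pi.mul_apply]
  have h1 : 1 + a * ψ T ω ≤ Real.exp (a * ψ T ω) := by
    linarith [Real.add_one_le_exp (a * ψ T ω)]
  calc W T ω * Real.exp (-(a * ψ T ω)) + a * (W T ω * Real.exp (-(a * ψ T ω))) * ψ T ω
      = W T ω * (Real.exp (-(a * ψ T ω)) * (1 + a * ψ T ω)) := by ring
    _ ≤ W T ω * (Real.exp (-(a * ψ T ω)) * Real.exp (a * ψ T ω)) := by
        have : 0 ≤ W T ω := (Real.exp_pos _).le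
        gcongr
    _ = W T ω := by rw [← Real.exp_add]; simp

/-- A nonnegative supermartingale converges almost surely; hence the exponent of the one
above is bounded along almost every path. -/
theorem ae_exists_compensated_le (hX : ∀ t, StronglyMeasurable[ℱ (t + 1)] (X t))
    (hX01 : ∀ t ω, X t ω = 0 ∨ X t ω = 1) (hψ : ∀ t, StronglyMeasurable[ℱ t] (ψ t))
    (hψ0 : ∀ t ω, 0 ≤ ψ t ω) (hψ1 : ∀ t ω, ψ t ω ≤ 1) (hc : ∀ t, P[X t | ℱ t] =ᵐ[P] ψ t) (l : ℝ) :
    ∀ᵐ ω ∂P, ∃ C, ∀ T, l * ∑ t ∈ Finset.range T, X t ω -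
      (Real.exp l - 1) * ∑ t ∈ Finset.range T, ψ t ω ≤ C := by
  have hs := supermartingale_exp_compensated hX hX01 hψ hψ0 hψ1 hc l
  set W : ℕ → Ω → ℝ := fun T ω => Real.exp (l * ∑ t ∈ Finset.range T, X t ω -
      (Real.exp l - 1) * ∑ t ∈ Finset.range T, ψ t ω) with hW
  have hbdd : ∀ n, eLpNorm ((-W) n) 1 P ≤ ((1 : NNReal) : ℝ≥0∞) := by
    intro n
    have h1 : ∫ ω, W n ω ∂P ≤ ∫ ω, W 0 ω ∂P := by
      simpa using hs.setIntegral_le (Nat.zero_le n) (MeasurableSet.univ (m := ℱ 0))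
    have h2 : ∫ ω, W 0 ω ∂P = 1 := by simp [hW]
    rw [Pi.neg_apply, eLpNorm_neg, eLpNorm_one_eq_lintegral_enorm,
      ← ofReal_integral_norm_eq_lintegral_enorm (hs.integrable n)]
    simp only [ENNReal.coe_one]
    rw [ENNReal.ofReal_le_one]
    refine le_trans (le_of_eq (integral_congr_ae (Eventually.of_forall fun ω => ?_)))
      (h1.trans h2.le)
    exact abs_of_pos (Real.exp_pos _)
  filter_upwards [hs.neg.exists_ae_tendsto_of_bdd hbdd] with ω ⟨c, hc⟩
  obtain ⟨C, hC⟩ := hc.bddBelow_range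
  refine ⟨Real.log (-C), fun T => ?_⟩
  have h : C ≤ -W T ω := hC ⟨T, rfl⟩
  have h' : W T ω ≤ -C := by linarith
  exact (Real.le_log_iff_exp_le ((Real.exp_pos _).trans_le h')).2 h'

/-- The number of occurrences of events and the sum of their conditional probabilities given
the past are asymptotically equivalent where the latter sum diverges, and their difference is
bounded where it converges. -/
theorem ae_abs_sum_sub_compensator_le (hX : ∀ t, StronglyMeasurable[ℱ (t + 1)] (X t))
    (hX01 : ∀ t ω, X t ω = 0 ∨ X t ω = 1) (hψ : ∀ t, StronglyMeasurable[ℱ t] (ψ t))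
    (hψ0 : ∀ t ω, 0 ≤ ψ t ω) (hψ1 : ∀ t ω, ψ t ω ≤ 1) (hc : ∀ t, P[X t | ℱ t] =ᵐ[P] ψ t) :
    ∀ᵐ ω ∂P, ∀ ε > 0, ∃ C, ∀ T, |∑ t ∈ Finset.range T, X t ω - ∑ t ∈ Finset.range T, ψ t ω| ≤
      ε * ∑ t ∈ Finset.range T, ψ t ω + C := by
  have hpos := fun m : ℕ => ae_exists_compensated_le hX hX01 hψ hψ0 hψ1 hc (1 / ((m : ℝ) + 1))
  have hneg := fun m : ℕ => ae_exists_compensated_le hX hX01 hψ hψ0 hψ1 hc (-(1 / ((m : ℝ) + 1)))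
  filter_upwards [ae_all_iff.2 hpos, ae_all_iff.2 hneg] with ω h1 h2 ε hε
  obtain ⟨m, hm⟩ := exists_nat_one_div_lt hε
  obtain ⟨C₁, hC₁⟩ := h1 m
  obtain ⟨C₂, hC₂⟩ := h2 m
  set l := 1 / ((m : ℝ) + 1) with hl
  have hl0 : 0 < l := Nat.one_div_pos_of_nat
  have hl1 : l ≤ 1 := by
    rw [hl, div_le_one (by positivity)]
    linarith [(Nat.cast_nonneg m : (0 : ℝ) ≤ m)]
  have e1 := Real.abs_exp_sub_one_sub_id_le (x := l) (by rwa [abs_of_pos hl0])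
  have e2 := Real.abs_exp_sub_one_sub_id_le (x := -l) (by rwa [abs_neg, abs_of_pos hl0])
  rw [abs_le] at e1 e2
  refine ⟨max C₁ C₂ / l, fun T => ?_⟩
  have hΨ : 0 ≤ ∑ t ∈ Finset.range T, ψ t ω := Finset.sum_nonneg fun t _ => hψ0 t ω
  specialize hC₁ T
  specialize hC₂ T
  set N := ∑ t ∈ Finset.range T, X t ω
  set Q := ∑ t ∈ Finset.range T, ψ t ω
  have key : l * |N - Q| ≤ l * (ε * Q) + max C₁ C₂ := by
    have hεl : l * l * Q ≤ l * (ε * Q) := by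
      rw [mul_assoc]; gcongr
    rw [← abs_of_pos hl0, ← abs_mul, abs_of_pos hl0, abs_le]
    constructor
    · have := mul_le_mul_of_nonneg_right e2.2 hΨ
      nlinarith [le_max_right C₁ C₂]
    · have := mul_le_mul_of_nonneg_right e1.2 hΨ
      nlinarith [le_max_left C₁ C₂]
  rw [← mul_le_mul_iff_right₀ hl0, mul_add, mul_div_cancel₀ _ hl0.ne']
  exact key

end Compensator

/-! ### Optional skipping -/

section OptionalSkipping

variable {Ω E : Type*} {B : ℕ → Set Ω} {U : ℕ → Ω → E}

open Classical in
/-- The event that the `n`-th occurrence (counted from `0`) among the events `B` is `B t`. -/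
def occurrence (B : ℕ → Set Ω) (n t : ℕ) : Set Ω :=
  {ω | ω ∈ B t ∧ Nat.count (fun s => ω ∈ B s) t = n}

/-- The event that `B t` occurs for more than `n` values of `t`. -/
def occursBeyond (B : ℕ → Set Ω) (n : ℕ) : Set Ω := ⋃ t, occurrence B n t

theorem nth_eq_of_mem_occurrence {n t : ℕ} {ω : Ω} (h : ω ∈ occurrence B n t) :
    Nat.nth (fun s => ω ∈ B s) n = t := by
  classical
  have := Nat.nth_count (p := fun s => ω ∈ B s) h.1
  rwa [h.2] at this

theorem disjoint_occurrence (n : ℕ) : Pairwise (Function.onFun Disjoint (occurrence B n)) := by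
  intro s t hst
  refine Set.disjoint_left.2 fun ω h1 h2 => hst ?_
  rw [← nth_eq_of_mem_occurrence h1, nth_eq_of_mem_occurrence h2]

theorem exists_occurrence_of_lt {n t i : ℕ} {ω : Ω} (h : ω ∈ occurrence B n t) (hi : i < n) :
    ∃ s < t, ω ∈ occurrence B i s := by
  classical
  have hi' : i < Nat.count (fun s => ω ∈ B s) t := by rw [h.2]; exact hi
  refine ⟨Nat.nth (fun s => ω ∈ B s) i, Nat.nth_lt_of_lt_count hi', ?_, ?_⟩
  · exact Nat.nth_mem i fun hf => hi'.trans_le (Nat.count_le_card hf t)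
  · exact Nat.count_nth fun hf => hi'.trans_le (Nat.count_le_card hf t)

theorem measurable_count {m : MeasurableSpace Ω} {T : ℕ}
    [∀ ω, DecidablePred fun s => ω ∈ B s] (hB : ∀ s < T, MeasurableSet (B s)) :
    Measurable fun ω => Nat.count (fun s => ω ∈ B s) T := by
  induction T with
  | zero => simp
  | succ T ih =>
    simp only [Nat.count_succ]
    refine (ih fun s hs => hB s (hs.trans T.lt_succ_self)).add ?_
    exact Measurable.ite (hB T T.lt_succ_self) measurable_const measurable_const

theorem measurableSet_occurrence {m : MeasurableSpace Ω} {t : ℕ}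
    (hB : ∀ s ≤ t, MeasurableSet (B s)) (n : ℕ) : MeasurableSet (occurrence B n t) := by
  classical
  exact (hB t le_rfl).inter
    (measurable_count (fun s hs => hB s hs.le) (measurableSet_singleton n))

open Classical in
/-- The values of `U` at the successive occurrences of the events `B`, continued by
`z` if there are only finitely many occurrences. -/
noncomputable def skipSeq (B : ℕ → Set Ω) (U : ℕ → Ω → E) (n : ℕ) (w : Ω × (ℕ → E)) : E :=
  if w.1 ∈ occursBeyond B n then U (Nat.nth (fun s => w.1 ∈ B s) n) w.1 else w.2 n

variable [mΩ : MeasurableSpace Ω] [MeasurableSpace E]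

theorem measurable_skipSeq (hB : ∀ t, MeasurableSet (B t)) (hU : ∀ t, Measurable (U t)) (n : ℕ) :
    Measurable (skipSeq B U n) := by
  classical
  intro F hF
  have hC : ∀ t, MeasurableSet (occurrence B n t) := fun t =>
    measurableSet_occurrence (fun s _ => hB s) n
  have : skipSeq B U n ⁻¹' F = (⋃ t, (occurrence B n t ∩ U t ⁻¹' F) ×ˢ (univ : Set (ℕ → E))) ∪
      (occursBeyond B n)ᶜ ×ˢ ((fun z : ℕ → E => z n) ⁻¹' F) := by
    ext ⟨ω, z⟩
    by_cases h : ω ∈ occursBeyond B n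
    · obtain ⟨t, ht⟩ := mem_iUnion.1 h
      have hnth := nth_eq_of_mem_occurrence ht
      simp only [skipSeq, mem_preimage, h, if_true, hnth, mem_union, mem_iUnion, mem_prod,
        mem_inter_iff, mem_univ, and_true, mem_compl_iff, not_true, false_and, or_false]
      refine ⟨fun hF => ⟨t, ht, hF⟩, ?_⟩
      rintro ⟨s, hs, hF⟩
      rwa [← hnth, nth_eq_of_mem_occurrence hs]
    · have h' : ∀ t, ω ∉ occurrence B n t := fun t ht => h (mem_iUnion.2 ⟨t, ht⟩)
      simp [skipSeq, h, h']
  rw [this]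
  refine (MeasurableSet.iUnion fun t => ((hC t).inter (hU t hF)).prod MeasurableSet.univ).union ?_
  exact (MeasurableSet.iUnion hC).compl.prod (measurable_pi_apply n hF)

variable {P : Measure Ω} {μ : Measure E} [IsProbabilityMeasure μ]
  {𝒢 : ℕ → MeasurableSpace Ω}

open Classical in
/-- The integrand is the probability, for given `ω`, that the first `n` terms of the sequence of
selected values lie in the given sets, if the sequence is continued by independent draws
from `μ`. -/
theorem lintegral_prod_skip [IsProbabilityMeasure P] (h𝒢 : ∀ t, 𝒢 t ≤ mΩ)
    (hB : ∀ t, ∀ s ≤ t, MeasurableSet[𝒢 t] (B s))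
    (hBU : ∀ t, ∀ s < t, ∀ F, MeasurableSet F → MeasurableSet[𝒢 t] (B s ∩ U s ⁻¹' F))
    (hU : ∀ t, Measurable (U t)) (hlaw : ∀ t, P.map (U t) = μ)
    (hind : ∀ t, Indep (MeasurableSpace.comap (U t) inferInstance) (𝒢 t) P)
    {F : ℕ → Set E} (hF : ∀ n, MeasurableSet (F n)) (n : ℕ) :
    ∫⁻ ω, ∏ i ∈ Finset.range n, (if ω ∈ occursBeyond B i then
      (F i).indicator 1 (U (Nat.nth (fun s => ω ∈ B s) i) ω) else μ (F i)) ∂P =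
    ∏ i ∈ Finset.range n, μ (F i) := by
  induction n with
  | zero => simp
  | succ n ih =>
    set g : ℕ → Ω → ℝ≥0∞ := fun i ω => if ω ∈ occursBeyond B i then
      (F i).indicator 1 (U (Nat.nth (fun s => ω ∈ B s) i) ω) else μ (F i) with hg
    have hC𝒢 : ∀ t, MeasurableSet[𝒢 t] (occurrence B n t) := fun t =>
      measurableSet_occurrence (hB t) n
    have hC : ∀ t, MeasurableSet (occurrence B n t) := fun t => h𝒢 t _ (hC𝒢 t)
    have hR : MeasurableSet (occursBeyond B n) := MeasurableSet.iUnion hC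
    have hon : ∀ i t ω, ω ∈ occurrence B i t → g i ω = (F i).indicator 1 (U t ω) := by
      intro i t ω h
      have h' : ω ∈ occursBeyond B i := mem_iUnion.2 ⟨t, h⟩
      simp only [hg, h', if_true, nth_eq_of_mem_occurrence h]
    -- at the `n`-th occurrence, the earlier factors are determined by the past
    set K : ℕ → Set Ω := fun t => occurrence B n t ∩
      ⋂ i ∈ Finset.range n, ⋃ s ∈ Finset.range t, occurrence B i s ∩ (B s ∩ U s ⁻¹' F i) with hK
    have hK𝒢 : ∀ t, MeasurableSet[𝒢 t] (K t) := by
      intro t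
      refine (hC𝒢 t).inter (Finset.measurableSet_biInter _ fun i _ =>
        Finset.measurableSet_biUnion _ fun s hs => ?_)
      have hs' := Finset.mem_range.1 hs
      exact (measurableSet_occurrence (fun r hr => hB t r (hr.trans hs'.le)) i).inter
        (hBU t s hs' _ (hF i))
    have hprod : ∀ t, ∀ ω ∈ occurrence B n t,
        ∏ i ∈ Finset.range n, g i ω = (K t).indicator 1 ω := by
      intro t ω hω
      by_cases hKω : ω ∈ K t
      · rw [indicator_of_mem hKω]
        refine Finset.prod_eq_one fun i hi => ?_
        obtain ⟨s, -, hs1, -, hs2⟩ := mem_iUnion₂.1 (mem_iInter₂.1 hKω.2 i hi)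
        rw [hon i s ω hs1, indicator_of_mem (show U s ω ∈ F i from hs2)]
        rfl
      · rw [indicator_of_notMem hKω]
        have : ∃ i ∈ Finset.range n,
            ω ∉ ⋃ s ∈ Finset.range t, occurrence B i s ∩ (B s ∩ U s ⁻¹' F i) := by
          by_contra! hcon
          exact hKω ⟨hω, mem_iInter₂.2 hcon⟩
        obtain ⟨i, hi, hnot⟩ := this
        obtain ⟨s, hst, hs⟩ := exists_occurrence_of_lt hω (Finset.mem_range.1 hi)
        refine Finset.prod_eq_zero hi ?_
        rw [hon i s ω hs]
        refine indicator_of_notMem (fun hmem => hnot ?_) _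
        exact mem_iUnion₂.2 ⟨s, Finset.mem_range.2 hst, hs, hs.1, hmem⟩
    have hstep : ∀ t, ∫⁻ ω in occurrence B n t, ∏ i ∈ Finset.range (n + 1), g i ω ∂P =
        (∫⁻ ω in occurrence B n t, ∏ i ∈ Finset.range n, g i ω ∂P) * μ (F n) := by
      intro t
      have hKm : MeasurableSet (K t) := h𝒢 t _ (hK𝒢 t)
      have hKC : K t ⊆ occurrence B n t := inter_subset_left
      have hUF : MeasurableSet (U t ⁻¹' F n) := hU t (hF n)
      have e1 : ∫⁻ ω in occurrence B n t, ∏ i ∈ Finset.range (n + 1), g i ω ∂P =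
          P (U t ⁻¹' F n ∩ K t) := by
        rw [setLIntegral_congr_fun (g := (U t ⁻¹' F n ∩ K t).indicator 1) (hC t) ?_,
          setLIntegral_indicator (hUF.inter hKm)]
        · simp only [Pi.one_apply, lintegral_const, one_mul, MeasurableSet.univ,
            Measure.restrict_apply, univ_inter]
          rw [inter_eq_left.2 (inter_subset_right.trans hKC)]
        · intro ω hω
          simp only
          rw [Finset.prod_range_succ, hprod t ω hω, hon n t ω hω]
          by_cases h1 : ω ∈ K t <;> by_cases h2 : U t ω ∈ F n <;> simp [h1, h2]
      have e2 : ∫⁻ ω in occurrence B n t, ∏ i ∈ Finset.range n, g i ω ∂P = P (K t) := by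
        rw [setLIntegral_congr_fun (g := (K t).indicator 1) (hC t) (hprod t),
          setLIntegral_indicator hKm]
        simp only [Pi.one_apply, lintegral_const, one_mul, MeasurableSet.univ,
          Measure.restrict_apply, univ_inter]
        rw [inter_eq_left.2 hKC]
      rw [e1, e2, (Indep_iff _ _ _).1 (hind t) _ _ ⟨F n, hF n, rfl⟩ (hK𝒢 t), ← hlaw t,
        Measure.map_apply (hU t) (hF n), mul_comm]
    have hrest : ∫⁻ ω in (occursBeyond B n)ᶜ, ∏ i ∈ Finset.range (n + 1), g i ω ∂P =
        (∫⁻ ω in (occursBeyond B n)ᶜ, ∏ i ∈ Finset.range n, g i ω ∂P) * μ (F n) := by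
      rw [← lintegral_mul_const' _ _ (measure_ne_top μ _)]
      refine setLIntegral_congr_fun hR.compl fun ω hω => ?_
      have hgn : g n ω = μ (F n) := if_neg hω
      rw [Finset.prod_range_succ, hgn]
    have hmain : ∫⁻ ω in occursBeyond B n, ∏ i ∈ Finset.range (n + 1), g i ω ∂P =
        (∫⁻ ω in occursBeyond B n, ∏ i ∈ Finset.range n, g i ω ∂P) * μ (F n) := by
      rw [occursBeyond, lintegral_iUnion hC (disjoint_occurrence n),
        lintegral_iUnion hC (disjoint_occurrence n), ← ENNReal.tsum_mul_right]
      exact tsum_congr hstep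
    calc ∫⁻ ω, ∏ i ∈ Finset.range (n + 1), g i ω ∂P
        = (∫⁻ ω, ∏ i ∈ Finset.range n, g i ω ∂P) * μ (F n) := by
          rw [← lintegral_add_compl _ hR, hrest, hmain, ← add_mul, lintegral_add_compl _ hR]
      _ = ∏ i ∈ Finset.range (n + 1), μ (F i) := by rw [Finset.prod_range_succ, ← ih]

theorem map_skipSeq [IsProbabilityMeasure P] (h𝒢 : ∀ t, 𝒢 t ≤ mΩ)
    (hB : ∀ t, ∀ s ≤ t, MeasurableSet[𝒢 t] (B s))
    (hBU : ∀ t, ∀ s < t, ∀ F, MeasurableSet F → MeasurableSet[𝒢 t] (B s ∩ U s ⁻¹' F))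
    (hU : ∀ t, Measurable (U t)) (hlaw : ∀ t, P.map (U t) = μ)
    (hind : ∀ t, Indep (MeasurableSpace.comap (U t) inferInstance) (𝒢 t) P) :
    (P.prod (Measure.infinitePi fun _ : ℕ => μ)).map (fun w n => skipSeq B U n w) =
      Measure.infinitePi fun _ : ℕ => μ := by
  classical
  have hBm : ∀ t, MeasurableSet (B t) := fun t => h𝒢 t _ (hB t t le_rfl)
  have hZ : Measurable fun (w : Ω × (ℕ → E)) n => skipSeq B U n w :=
    measurable_pi_lambda _ fun n => measurable_skipSeq hBm hU n
  refine Measure.eq_infinitePi _ fun s F hF => ?_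
  obtain ⟨n, hn⟩ := s.exists_nat_subset_range
  set F' : ℕ → Set E := fun i => if i ∈ s then F i else univ with hF'
  have hF'm : ∀ i, MeasurableSet (F' i) := by
    intro i
    by_cases h : i ∈ s <;> simp [hF', h, hF]
  have hbox : (s : Set ℕ).pi F = (Finset.range n : Set ℕ).pi F' := by
    ext z
    simp only [Set.mem_pi, Finset.mem_coe, hF']
    constructor
    · intro h i _
      by_cases his : i ∈ s
      · simpa [his] using h i his
      · simp [his]
    · intro h i his
      have := h i (hn his)
      rwa [if_pos his] at this
  have hval : ∏ i ∈ s, μ (F i) = ∏ i ∈ Finset.range n, μ (F' i) := by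
    rw [← Finset.prod_subset hn]
    · exact Finset.prod_congr rfl fun i hi => by simp [hF', hi]
    · intro i _ hi
      simp [hF', hi]
  have hboxm : MeasurableSet ((Finset.range n : Set ℕ).pi F') :=
    MeasurableSet.pi (Finset.range n).countable_toSet fun i _ => hF'm i
  rw [hbox, hval, Measure.map_apply hZ hboxm, Measure.prod_apply (hZ hboxm),
    ← lintegral_prod_skip h𝒢 hB hBU hU hlaw hind hF'm n]
  refine lintegral_congr fun ω => ?_
  -- for fixed `ω`, the condition on the continuation `z` is again a box
  set V : ℕ → Set E := fun i => if ω ∈ occursBeyond B i then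
    {_z | U (Nat.nth (fun s => ω ∈ B s) i) ω ∈ F' i} else F' i with hV
  have hVm : ∀ i ∈ Finset.range n, MeasurableSet (V i) := by
    intro i _
    by_cases h : ω ∈ occursBeyond B i <;> simp [hV, h, hF'm]
  have hsec : Prod.mk ω ⁻¹' ((fun (w : Ω × (ℕ → E)) n => skipSeq B U n w) ⁻¹'
      (Finset.range n : Set ℕ).pi F') = (Finset.range n : Set ℕ).pi V := by
    ext z
    simp only [mem_preimage, Set.mem_pi, skipSeq, hV]
    refine forall₂_congr fun i _ => ?_
    by_cases h : ω ∈ occursBeyond B i <;> simp [h]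
  rw [hsec, Measure.infinitePi_pi _ hVm]
  refine Finset.prod_congr rfl fun i _ => ?_
  by_cases h : ω ∈ occursBeyond B i
  · by_cases h' : U (Nat.nth (fun s => ω ∈ B s) i) ω ∈ F' i <;> simp [hV, h, h']
  · simp [hV, h]

/-- Optional skipping: if at each time it is decided without anticipation whether
the next term of an i.i.d. sequence is selected, then the selected terms, if infinite in number,
have almost surely every property which an i.i.d. sequence of the same law has almost surely. -/
theorem ae_of_ae_infinitePi [IsProbabilityMeasure P] (h𝒢 : ∀ t, 𝒢 t ≤ mΩ)
    (hB : ∀ t, ∀ s ≤ t, MeasurableSet[𝒢 t] (B s))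
    (hBU : ∀ t, ∀ s < t, ∀ F, MeasurableSet F → MeasurableSet[𝒢 t] (B s ∩ U s ⁻¹' F))
    (hU : ∀ t, Measurable (U t)) (hlaw : ∀ t, P.map (U t) = μ)
    (hind : ∀ t, Indep (MeasurableSpace.comap (U t) inferInstance) (𝒢 t) P)
    {Q : (ℕ → E) → Prop} (hQ : ∀ᵐ z ∂(Measure.infinitePi fun _ : ℕ => μ), Q z) :
    ∀ᵐ ω ∂P, {t | ω ∈ B t}.Infinite → Q fun n => U (Nat.nth (fun s => ω ∈ B s) n) ω := by
  classical
  have hBm : ∀ t, MeasurableSet (B t) := fun t => h𝒢 t _ (hB t t le_rfl)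
  have hZ : Measurable fun (w : Ω × (ℕ → E)) n => skipSeq B U n w :=
    measurable_pi_lambda _ fun n => measurable_skipSeq hBm hU n
  rw [← map_skipSeq h𝒢 hB hBU hU hlaw hind] at hQ
  filter_upwards [Measure.ae_ae_of_ae_prod (ae_of_ae_map hZ.aemeasurable hQ)] with ω hω hinf
  obtain ⟨z, hz⟩ := hω.exists
  convert hz using 2 with n
  have : ω ∈ occursBeyond B n := mem_iUnion.2 ⟨Nat.nth (fun s => ω ∈ B s) n,
    Nat.nth_mem_of_infinite hinf n, Nat.count_nth_of_infinite hinf n⟩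
  simp [skipSeq, this]

theorem sum_ite_eq_sum_count {M : Type*} [AddCommMonoid M] (p : ℕ → Prop) [DecidablePred p]
    (f : ℕ → M) (T : ℕ) :
    ∑ t ∈ Finset.range T, (if p t then f t else 0) =
      ∑ n ∈ Finset.range (Nat.count p T), f (Nat.nth p n) := by
  induction T with
  | zero => simp
  | succ T ih =>
    rw [Finset.sum_range_succ, ih, Nat.count_succ]
    by_cases h : p T
    · simp [h, Finset.sum_range_succ, Nat.nth_count h]
    · simp [h]

end OptionalSkipping

/-! ### Kullback-Leibler divergences -/

section Divergence

variable {k : ℕ} {ν : Measure ℝ} {p : Param k → ℝ → ℝ} {Θ : Set (Param k)}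

theorem IsDensityFamily.isProbabilityMeasure_law (h : IsDensityFamily ν p Θ) {θ : Param k}
    (hθ : θ ∈ Θ) : IsProbabilityMeasure (law ν p θ) :=
  ⟨by rw [law, withDensity_apply _ MeasurableSet.univ, Measure.restrict_univ,
    h.lintegral_eq_one θ hθ]⟩

theorem KL_self (ν : Measure ℝ) (p : Param k → ℝ → ℝ) (θ : Param k) : KL ν p θ θ = 0 := by
  have : ∀ y, logLR p θ θ y = 0 := by
    intro y
    by_cases h : p θ y = 0 <;> simp [logLR, h]
  simp [KL, this]

/-- Gibbs' inequality, from `log x ≤ x - 1`. -/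
theorem IsDensityFamily.KL_nonneg (h : IsDensityFamily ν p Θ) {θ₀ θ : Param k} (hθ₀ : θ₀ ∈ Θ)
    (hθ : θ ∈ Θ) (hint : Integrable (logLR p θ₀ θ) (law ν p θ₀)) : 0 ≤ KL ν p θ₀ θ := by
  have hprob := h.isProbabilityMeasure_law hθ₀
  have hm : Measurable fun y => p θ y / p θ₀ y := (h.measurable θ hθ).div (h.measurable θ₀ hθ₀)
  have hle : ∫⁻ y, ENNReal.ofReal (p θ y / p θ₀ y) ∂(law ν p θ₀) ≤ 1 := by
    rw [law, lintegral_withDensity_eq_lintegral_mul _ (h.measurable θ₀ hθ₀).ennreal_ofReal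
      hm.ennreal_ofReal, ← h.lintegral_eq_one θ hθ]
    refine lintegral_mono fun y => ?_
    simp only [Pi.mul_apply]
    rw [← ENNReal.ofReal_mul (h.nonneg θ₀ hθ₀ y)]
    refine ENNReal.ofReal_le_ofReal ?_
    by_cases h0 : p θ₀ y = 0
    · simp [h0, h.nonneg θ hθ y]
    · rw [mul_div_cancel₀ _ h0]
  have hnn : ∀ y, 0 ≤ p θ y / p θ₀ y := fun y =>
    div_nonneg (h.nonneg θ hθ y) (h.nonneg θ₀ hθ₀ y)
  have hri : Integrable (fun y => p θ y / p θ₀ y) (law ν p θ₀) := by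
    refine ⟨hm.aestronglyMeasurable, ?_⟩
    rw [hasFiniteIntegral_iff_ofReal (Eventually.of_forall hnn)]
    exact hle.trans_lt ENNReal.one_lt_top
  have hr1 : ∫ y, p θ y / p θ₀ y ∂(law ν p θ₀) ≤ 1 := by
    rw [integral_eq_lintegral_of_nonneg_ae (Eventually.of_forall hnn) hm.aestronglyMeasurable]
    exact ENNReal.toReal_mono ENNReal.one_ne_top hle
  calc (0 : ℝ) ≤ ∫ y, (1 - p θ y / p θ₀ y) ∂(law ν p θ₀) := by
        rw [integral_sub (integrable_const _) hri]
        simpa using hr1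
    _ ≤ ∫ y, logLR p θ₀ θ y ∂(law ν p θ₀) := by
        refine integral_mono_ae ((integrable_const _).sub hri) hint ?_
        filter_upwards [h.ae_pos θ₀ hθ₀] with y hy
        have h1 := Real.log_le_sub_one_of_pos (div_pos (hy θ hθ) (hy θ₀ hθ₀))
        have h2 : logLR p θ₀ θ y = -Real.log (p θ y / p θ₀ y) := by
          rw [logLR, ← Real.log_inv, inv_div]
        rw [h2]
        linarith

end Divergence

/-! ### Likelihoods of the single designs -/

/-- Multiplication in `ℝ≥0∞` is continuous at finite values only, whence `htop`. -/
theorem continuousOn_ennreal_prod {X ι : Type*} [TopologicalSpace X] {B : Set X}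
    {f : ι → X → ℝ≥0∞} {s : Finset ι} (hf : ∀ i ∈ s, ContinuousOn (f i) B)
    (htop : ∀ i ∈ s, ∀ x ∈ B, f i x ≠ ∞) : ContinuousOn (fun x => ∏ i ∈ s, f i x) B := by
  classical
  induction s using Finset.induction_on with
  | empty => simpa using continuousOn_const
  | insert i s hi ih =>
    simp only [Finset.prod_insert hi]
    rw [Finset.forall_mem_insert] at hf htop
    intro x hx
    exact ENNReal.Tendsto.mul (hf.1 x hx) (Or.inr (ENNReal.prod_ne_top fun j hj => htop.2 j hj x hx))
      (ih hf.2 htop.2 x hx) (Or.inr (htop.1 x hx))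

section Likelihood

variable {k : ℕ} {𝓓 Ω : Type*} [DecidableEq 𝓓] {p : Param k → ℝ → ℝ} {Θ : Set (Param k)}
  {Y : ℕ → Ω → 𝓓 → ℝ} {A : ℕ → Ω → 𝓓}

/-- The log-likelihood of the parameter `θ₀` relative to `x`, in the outcomes observed from the
design `d` at the first `T` steps. -/
noncomputable def designLogLR (p : Param k → ℝ → ℝ) (Y : ℕ → Ω → 𝓓 → ℝ) (A : ℕ → Ω → 𝓓) (T : ℕ)
    (ω : Ω) (d : 𝓓) (θ₀ x : Param k) : ℝ :=
  ∑ t ∈ Finset.range T, if A t ω = d then logLR p θ₀ x (Y t ω d) else 0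

/-- The likelihood of the parameter `x` in the outcomes observed from the design `d` at the first
`T` steps. -/
noncomputable def designLikelihood (p : Param k → ℝ → ℝ) (Y : ℕ → Ω → 𝓓 → ℝ) (A : ℕ → Ω → 𝓓)
    (T : ℕ) (ω : Ω) (d : 𝓓) (x : Param k) : ℝ≥0∞ :=
  ∏ t ∈ Finset.range T, if A t ω = d then ENNReal.ofReal (p x (Y t ω d)) else 1

theorem likelihood_eq_prod [Fintype 𝓓] (T : ℕ) (ω : Ω) (θ : 𝓓 → Param k) :
    likelihood p Y A T ω θ = ∏ d, designLikelihood p Y A T ω d (θ d) := by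
  simp only [likelihood, designLikelihood]
  rw [Finset.prod_comm]
  simp

theorem designLikelihood_ne_top (T : ℕ) (ω : Ω) (d : 𝓓) (x : Param k) :
    designLikelihood p Y A T ω d x ≠ ∞ := by
  refine ENNReal.prod_ne_top fun t _ => ?_
  split_ifs <;> simp

variable {ω : Ω} {d : 𝓓}

theorem designLikelihood_ne_zero (hpos : ∀ t, ∀ x ∈ Θ, 0 < p x (Y t ω d)) (T : ℕ) {x : Param k}
    (hx : x ∈ Θ) : designLikelihood p Y A T ω d x ≠ 0 := by
  refine Finset.prod_ne_zero_iff.2 fun t _ => ?_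
  split_ifs
  · simpa using hpos t x hx
  · simp

theorem continuousOn_designLikelihood (hcont : ∀ y, ContinuousOn (fun θ => p θ y) Θ) (T : ℕ) :
    ContinuousOn (designLikelihood p Y A T ω d) Θ := by
  refine continuousOn_ennreal_prod (fun t _ => ?_) fun t _ x _ => by split_ifs <;> simp
  split_ifs
  · exact ENNReal.continuous_ofReal.comp_continuousOn (hcont _)
  · exact continuousOn_const

theorem designLikelihood_eq_exp (hpos : ∀ t, ∀ x ∈ Θ, 0 < p x (Y t ω d)) (T : ℕ)
    {θ₀ x : Param k} (hθ₀ : θ₀ ∈ Θ) (hx : x ∈ Θ) :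
    designLikelihood p Y A T ω d x =
      designLikelihood p Y A T ω d θ₀ *
        ENNReal.ofReal (Real.exp (-designLogLR p Y A T ω d θ₀ x)) := by
  simp only [designLikelihood, designLogLR]
  rw [← Finset.sum_neg_distrib, Real.exp_sum,
    ENNReal.ofReal_prod_of_nonneg fun _ _ => (Real.exp_pos _).le, ← Finset.prod_mul_distrib]
  refine Finset.prod_congr rfl fun t _ => ?_
  split_ifs
  · have h0 := hpos t θ₀ hθ₀
    have h1 := hpos t x hx
    rw [← ENNReal.ofReal_mul h0.le, logLR, ← Real.log_inv, Real.exp_log (by positivity), inv_div,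
      mul_div_cancel₀ _ h0.ne']
  · simp

theorem continuousOn_designLogLR (hcont : ∀ y, ContinuousOn (fun θ => p θ y) Θ)
    (hpos : ∀ t, ∀ x ∈ Θ, 0 < p x (Y t ω d)) (T : ℕ) {θ₀ : Param k} (hθ₀ : θ₀ ∈ Θ) :
    ContinuousOn (designLogLR p Y A T ω d θ₀) Θ := by
  refine continuousOn_finsetSum _ fun t _ => ?_
  split_ifs
  · refine ContinuousOn.log (continuousOn_const.div (hcont _) fun x hx => (hpos t x hx).ne')
      fun x hx => (div_pos (hpos t θ₀ hθ₀) (hpos t x hx)).ne'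
  · exact continuousOn_const

end Likelihood

/-! ### Uniform asymptotics of the log-likelihoods -/

section Sampling

theorem measurableSet_observed {𝓓 Ω : Type*} [MeasurableSpace 𝓓] {Y : ℕ → Ω → 𝓓 → ℝ}
    {A : ℕ → Ω → 𝓓} {s t : ℕ} (hst : s < t) {F : Set (𝓓 × ℝ)} (hF : MeasurableSet F) :
    MeasurableSet[observed Y A t] {ω | (A s ω, Y s ω (A s ω)) ∈ F} := by
  have h : MeasurableSpace.comap (fun ω => (A s ω, Y s ω (A s ω))) inferInstance ≤
      observed Y A t := le_iSup₂_of_le s (Finset.mem_range.2 hst) le_rfl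
  exact h _ ⟨F, hF, rfl⟩

theorem measurableSet_observed_eq {𝓓 Ω : Type*} [MeasurableSpace 𝓓] [MeasurableSingletonClass 𝓓]
    {Y : ℕ → Ω → 𝓓 → ℝ} {A : ℕ → Ω → 𝓓} {s t : ℕ} (hst : s < t) (d : 𝓓) :
    MeasurableSet[observed Y A t] {ω | A s ω = d} :=
  measurableSet_observed hst (measurable_fst (measurableSet_singleton d))

variable {k : ℕ} {𝓓 Ω : Type*} [Fintype 𝓓] [DecidableEq 𝓓] [MeasurableSpace 𝓓]
  [mΩ : MeasurableSpace Ω]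
  {P : Measure Ω} {ν : Measure ℝ} {p : Param k → ℝ → ℝ} {Θ : Set (Param k)}
  {θstar : 𝓓 → Param k} {Y : ℕ → Ω → 𝓓 → ℝ} {A : ℕ → Ω → 𝓓} {ψ : ℕ → 𝓓 → Ω → ℝ}

theorem IsSequentialSampling.observed_le [MeasurableSingletonClass 𝓓]
    (hψ : IsSequentialSampling P ν p θstar Y A ψ) (t : ℕ) : observed Y A t ≤ mΩ := by
  refine iSup₂_le fun s _ => Measurable.comap_le ?_
  have hev : Measurable fun q : 𝓓 × (𝓓 → ℝ) => q.2 q.1 :=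
    measurable_from_prod_countable_right fun d => measurable_pi_apply d
  exact (hψ.measurable_A s).prodMk (hev.comp ((hψ.measurable_A s).prodMk (hψ.measurable_Y s)))

/-- The filtration of the observations. -/
def observedFiltration [MeasurableSingletonClass 𝓓]
    (hψ : IsSequentialSampling P ν p θstar Y A ψ) : Filtration ℕ mΩ where
  seq := observed Y A
  mono' := fun _ _ hst => biSup_mono fun _ hr =>
    Finset.mem_range.2 ((Finset.mem_range.1 hr).trans_le hst)
  le' := hψ.observed_le

theorem IsSequentialSampling.map_eval [∀ d, IsProbabilityMeasure (law ν p (θstar d))]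
    (hψ : IsSequentialSampling P ν p θstar Y A ψ) (t : ℕ) (d : 𝓓) :
    P.map (fun ω => Y t ω d) = law ν p (θstar d) := by
  have h := (measurePreserving_eval (fun d => law ν p (θstar d)) d).map_eq
  rw [← hψ.map_Y t, Measure.map_map (measurable_pi_apply d) (hψ.measurable_Y t)] at h
  exact h

theorem IsSequentialSampling.ae_pos (hreg : IsRegularFamily ν p Θ) (hθ : ∀ d, θstar d ∈ Θ)
    (hψ : IsSequentialSampling P ν p θstar Y A ψ) :
    ∀ᵐ ω ∂P, ∀ d t, ∀ x ∈ Θ, 0 < p x (Y t ω d) := by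
  have := fun d => hreg.density.isProbabilityMeasure_law (hθ d)
  refine ae_all_iff.2 fun d => ae_all_iff.2 fun t => ?_
  refine ae_of_ae_map ((measurable_pi_apply d).comp (hψ.measurable_Y t)).aemeasurable
    (p := fun y => ∀ x ∈ Θ, 0 < p x y) ?_
  have h := hψ.map_eval t d
  rw [Function.comp_def, h]
  exact hreg.density.ae_pos _ (hθ d)

/-- The number of times that a design is sampled is asymptotically equivalent to the sum of its
sampling probabilities, if the latter diverges. -/
theorem IsSequentialSampling.ae_abs_count_sub_le [IsProbabilityMeasure P]
    [MeasurableSingletonClass 𝓓] (hψ : IsSequentialSampling P ν p θstar Y A ψ) (d : 𝓓) :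
    ∀ᵐ ω ∂P, ∀ ε > 0, ∃ C, ∀ T : ℕ,
      |(Nat.count (fun t => A t ω = d) T : ℝ) - ∑ t ∈ Finset.range T, ψ t d ω| ≤
        ε * ∑ t ∈ Finset.range T, ψ t d ω + C := by
  have hcount : ∀ (T : ℕ) (ω : Ω), (Nat.count (fun t => A t ω = d) T : ℝ) =
      ∑ t ∈ Finset.range T, if A t ω = d then (1 : ℝ) else 0 := by
    intro T ω
    rw [sum_ite_eq_sum_count (fun t => A t ω = d) (fun _ => (1 : ℝ))]
    simp
  simp only [hcount]
  refine ae_abs_sum_sub_compensator_le (ℱ := observedFiltration hψ) (ψ := fun t => ψ t d)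
    (X := fun t ω => if A t ω = d then (1 : ℝ) else 0) (fun t => ?_) (fun t ω => ?_)
    (fun t => ?_) (fun t => hψ.nonneg t d) (fun t ω => ?_) (fun t => hψ.condProb t d)
  · refine Measurable.stronglyMeasurable ?_
    exact Measurable.ite (measurableSet_observed_eq t.lt_succ_self d) measurable_const
      measurable_const
  · split_ifs <;> simp
  · exact (hψ.adapted t d).stronglyMeasurable
  · rw [← hψ.sum_eq_one t ω]
    exact Finset.single_le_sum (f := fun d => ψ t d ω) (fun d _ => hψ.nonneg t d ω)
      (Finset.mem_univ d)

/-- The uniform law of large numbers holds for the outcomes observed from a design which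
is sampled infinitely often. -/
theorem IsSequentialSampling.ae_tendstoUniformlyOn [IsProbabilityMeasure P]
    [MeasurableSingletonClass 𝓓] (hreg : IsRegularFamily ν p Θ) (hθ : ∀ d, θstar d ∈ Θ)
    (hψ : IsSequentialSampling P ν p θstar Y A ψ) (d : 𝓓) :
    ∀ᵐ ω ∂P, {t | A t ω = d}.Infinite →
      TendstoUniformlyOn
        (fun (n : ℕ) (q : Param k × Param k) => (1 / (n : ℝ)) *
          ∑ i ∈ Finset.range n, logLR p q.1 q.2 (Y (Nat.nth (fun t => A t ω = d) i) ω d))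
        (fun q : Param k × Param k => ∫ z, logLR p q.1 q.2 z ∂(law ν p (θstar d)))
        atTop (Θ ×ˢ Θ) := by
  have := fun d => hreg.density.isProbabilityMeasure_law (hθ d)
  have hcomp : ∀ t, MeasurableSpace.comap (A t) inferInstance ≤ mΩ := fun t =>
    (hψ.measurable_A t).comap_le
  refine ae_of_ae_infinitePi (B := fun t => {ω | A t ω = d}) (U := fun t ω => Y t ω d)
    (𝒢 := fun t => observed Y A t ⊔ MeasurableSpace.comap (A t) inferInstance)
    (fun t => sup_le (hψ.observed_le t) (hcomp t)) (fun t s hst => ?_) (fun t s hst F hF => ?_)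
    (fun t => (measurable_pi_apply d).comp (hψ.measurable_Y t)) (fun t => hψ.map_eval t d)
    (fun t => ?_) (hreg.glivenkoCantelli _ (hθ d)).2
  · rcases hst.lt_or_eq with h | rfl
    · exact (le_sup_left (α := MeasurableSpace Ω)) _ (measurableSet_observed_eq h d)
    · exact (le_sup_right (α := MeasurableSpace Ω)) _ ⟨{d}, measurableSet_singleton d, rfl⟩
  · refine (le_sup_left (α := MeasurableSpace Ω)) _ ?_
    have : {ω | A s ω = d} ∩ (fun ω => Y s ω d) ⁻¹' F =
        {ω | (A s ω, Y s ω (A s ω)) ∈ ({d} : Set 𝓓) ×ˢ F} := by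
      ext ω
      simp only [mem_inter_iff, mem_ofPred_eq, mem_preimage, mem_prod, mem_singleton_iff]
      refine and_congr_right fun h => ?_
      rw [h]
    rw [this]
    exact measurableSet_observed hst ((measurableSet_singleton d).prod hF)
  · refine indep_of_indep_of_le_left (hψ.nonanticipating t) ?_
    rintro _ ⟨F, hF, rfl⟩
    exact ⟨_, measurable_pi_apply d hF, rfl⟩

/-- Uniformly over `Θ`, the log-likelihood ratio in the observations from a design grows like
the divergence times the number of observations. The bound holds also when this number stays finite;
then the log-likelihood ratio is eventually a fixed continuous function on a compact set. -/
theorem IsSequentialSampling.ae_abs_designLogLR_sub_count_le [IsProbabilityMeasure P]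
    [MeasurableSingletonClass 𝓓] (hreg : IsRegularFamily ν p Θ) (hθ : ∀ d, θstar d ∈ Θ)
    (hKL : ∀ d, ContinuousOn (KL ν p (θstar d)) Θ)
    (hψ : IsSequentialSampling P ν p θstar Y A ψ) (d : 𝓓) :
    ∀ᵐ ω ∂P, ∀ ε > 0, ∃ C, ∀ᶠ T : ℕ in atTop, ∀ x ∈ Θ,
      |designLogLR p Y A T ω d (θstar d) x -
        Nat.count (fun t => A t ω = d) T * KL ν p (θstar d) x| ≤
        ε * Nat.count (fun t => A t ω = d) T + C := by
  filter_upwards [hψ.ae_pos hreg hθ, hψ.ae_tendstoUniformlyOn hreg hθ d] with ω hpos hω ε hε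
  by_cases hinf : {t | A t ω = d}.Infinite
  · have hcount : Tendsto (Nat.count fun t => A t ω = d) atTop atTop :=
      tendsto_atTop_atTop_of_monotone (Nat.count_monotone _) fun b =>
        ⟨Nat.nth (fun t => A t ω = d) b, (Nat.count_nth_of_infinite hinf b).ge⟩
    refine ⟨0, ?_⟩
    filter_upwards [hcount.eventually (Metric.tendstoUniformlyOn_iff.1 (hω hinf) ε hε),
      hcount.eventually_gt_atTop 0] with T hT hN x hx
    have h := hT (θstar d, x) ⟨hθ d, hx⟩
    rw [dist_comm, Real.dist_eq] at h
    have hN' : (0 : ℝ) < Nat.count (fun t => A t ω = d) T := by exact_mod_cast hN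
    rw [designLogLR, sum_ite_eq_sum_count (fun t => A t ω = d)
      (fun t => logLR p (θstar d) x (Y t ω d)), add_zero, KL]
    set N : ℝ := ((Nat.count (fun t => A t ω = d) T : ℕ) : ℝ)
    set s := ∑ n ∈ Finset.range (Nat.count (fun t => A t ω = d) T),
      logLR p (θstar d) x (Y (Nat.nth (fun t => A t ω = d) n) ω d)
    set I := ∫ y, logLR p (θstar d) x y ∂law ν p (θstar d)
    have e : s - N * I = N * (1 / N * s - I) := by field_simp
    rw [e, abs_mul, abs_of_pos hN', mul_comm]
    exact mul_le_mul_of_nonneg_right h.le hN'.le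
  · obtain ⟨T₀, hT₀⟩ := (not_infinite.1 hinf).bddAbove
    have hno : ∀ t, T₀ + 1 ≤ t → A t ω ≠ d := fun t ht h => by
      have := hT₀ (show t ∈ {t | A t ω = d} from h)
      omega
    have hconst : ∀ T, T₀ + 1 ≤ T → ∀ x,
        designLogLR p Y A T ω d (θstar d) x = designLogLR p Y A (T₀ + 1) ω d (θstar d) x := by
      intro T hT x
      refine (Finset.sum_subset (Finset.range_mono hT) fun t _ ht => ?_).symm
      rw [if_neg (hno t (by simpa using ht))]
    have hcount : ∀ T, T₀ + 1 ≤ T →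
        Nat.count (fun t => A t ω = d) T = Nat.count (fun t => A t ω = d) (T₀ + 1) := by
      intro T hT
      induction T, hT using Nat.le_induction with
      | base => rfl
      | succ T hT ih => rw [Nat.count_succ, ih, if_neg (hno T hT), add_zero]
    obtain ⟨C, hC⟩ := hreg.compact.exists_bound_of_continuousOn
      ((continuousOn_designLogLR (A := A) hreg.continuous (hpos d) (T₀ + 1) (hθ d)).sub
        ((hKL d).const_smul (Nat.count (fun t => A t ω = d) (T₀ + 1) : ℝ)))
    refine ⟨C, ?_⟩
    filter_upwards [eventually_ge_atTop (T₀ + 1)] with T hT x hx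
    rw [hconst T hT, hcount T hT]
    have h := hC x hx
    simp only [Real.norm_eq_abs] at h
    refine h.trans (le_add_of_nonneg_left (by positivity))

theorem IsSequentialSampling.ae_abs_designLogLR_sub_le [IsProbabilityMeasure P]
    [MeasurableSingletonClass 𝓓] (hreg : IsRegularFamily ν p Θ) (hθ : ∀ d, θstar d ∈ Θ)
    (hKL : ∀ d, ContinuousOn (KL ν p (θstar d)) Θ)
    (hψ : IsSequentialSampling P ν p θstar Y A ψ) :
    ∀ᵐ ω ∂P, ∀ d, ∀ ε > 0, ∃ C, ∀ᶠ T : ℕ in atTop, ∀ x ∈ Θ,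
      |designLogLR p Y A T ω d (θstar d) x -
        (∑ t ∈ Finset.range T, ψ t d ω) * KL ν p (θstar d) x| ≤
        ε * (∑ t ∈ Finset.range T, ψ t d ω) + C := by
  refine ae_all_iff.2 fun d => ?_
  obtain ⟨K, hK⟩ := hreg.compact.exists_bound_of_continuousOn (hKL d)
  have hK0 : 0 ≤ K := (norm_nonneg _).trans (hK _ (hθ d))
  filter_upwards [hψ.ae_abs_designLogLR_sub_count_le hreg hθ hKL d, hψ.ae_abs_count_sub_le d]
    with ω h1 h2 ε hε
  set η := min 1 (ε / (2 + K)) with hη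
  have hη0 : 0 < η := lt_min one_pos (by positivity)
  have hη1 : η ≤ 1 := min_le_left _ _
  have hηε : η * (2 + K) ≤ ε := by
    have := min_le_right 1 (ε / (2 + K))
    rwa [← hη, le_div_iff₀ (by positivity)] at this
  obtain ⟨C₁, hC₁⟩ := h1 η hη0
  obtain ⟨C₂, hC₂⟩ := h2 η hη0
  refine ⟨C₁ + |C₂| + |C₂| * K, ?_⟩
  filter_upwards [hC₁] with T hT x hx
  have hx1 := hT x hx
  have hx2 := hC₂ T
  have hx3 : |KL ν p (θstar d) x| ≤ K := hK x hx
  have hQ : 0 ≤ ∑ t ∈ Finset.range T, ψ t d ω := Finset.sum_nonneg fun t _ => hψ.nonneg t d ω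
  set L := designLogLR p Y A T ω d (θstar d) x
  set N : ℝ := ((Nat.count (fun t => A t ω = d) T : ℕ) : ℝ)
  set Q := ∑ t ∈ Finset.range T, ψ t d ω
  set κ := KL ν p (θstar d) x
  have hC₂' : η * Q + C₂ ≤ η * Q + |C₂| := by linarith [le_abs_self C₂]
  have hN : N ≤ Q + η * Q + |C₂| := by linarith [(abs_le.1 hx2).2]
  have hQη : η * Q ≤ Q := mul_le_of_le_one_left hQ hη1
  calc |L - Q * κ| = |(L - N * κ) + (N - Q) * κ| := by ring_nf
    _ ≤ |L - N * κ| + |N - Q| * |κ| := by rw [← abs_mul]; exact abs_add_le _ _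
    _ ≤ (η * N + C₁) + (η * Q + |C₂|) * K := by
        gcongr
        exact hx2.trans hC₂'
    _ ≤ (η * (Q + Q) + |C₂| + C₁) + (η * Q + |C₂|) * K := by
        have h5 : η * N ≤ η * (Q + Q) + |C₂| := by
          have h6 : η * |C₂| ≤ |C₂| := mul_le_of_le_one_left (abs_nonneg _) hη1
          have h7 : η * N ≤ η * (Q + Q + |C₂|) :=
            mul_le_mul_of_nonneg_left (by linarith) hη0.le
          linarith
        linarith
    _ = η * (2 + K) * Q + (C₁ + |C₂| + |C₂| * K) := by ring
    _ ≤ ε * Q + (C₁ + |C₂| + |C₂| * K) := by gcongr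

end Sampling

/-! ### Integrals of product likelihoods -/

section ProductIntegral

theorem setLIntegral_lt_top_of_continuousOn {X : Type*} [TopologicalSpace X] [MeasurableSpace X]
    {μ : Measure X} [IsFiniteMeasureOnCompacts μ] {B : Set X} (hB : IsCompact B) {f : X → ℝ≥0∞}
    (hf : ContinuousOn f B) (htop : ∀ x ∈ B, f x ≠ ∞) : ∫⁻ x in B, f x ∂μ < ∞ := by
  rcases B.eq_empty_or_nonempty with rfl | hne
  · simp
  obtain ⟨x, hx, hmax⟩ := hB.exists_isMaxOn hne hf
  calc ∫⁻ y in B, f y ∂μ ≤ ∫⁻ _ in B, f x ∂μ := setLIntegral_mono measurable_const hmax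
    _ = f x * μ B := setLIntegral_const _ _
    _ < ∞ := ENNReal.mul_lt_top (htop x hx).lt_top hB.measure_lt_top

theorem setLIntegral_ne_zero {X : Type*} [MeasurableSpace X] {μ : Measure X} {S : Set X}
    (hS : MeasurableSet S) (hμ : μ S ≠ 0) {f : X → ℝ≥0∞} (hf : AEMeasurable f (μ.restrict S))
    (h0 : ∀ x ∈ S, f x ≠ 0) : ∫⁻ x in S, f x ∂μ ≠ 0 := by
  intro h
  rw [lintegral_eq_zero_iff' hf, EventuallyEq, ae_restrict_iff' hS] at h
  refine hμ (measure_eq_zero_iff_ae_notMem.2 ?_)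
  filter_upwards [h] with x hx hxS
  exact h0 x hxS (hx hxS)

theorem isCompact_paramSpace {k : ℕ} {I : Type*} {Θ : Set (Param k)} (hΘ : IsCompact Θ) :
    IsCompact (paramSpace I Θ) :=
  isCompact_univ_pi fun _ => hΘ

instance isOpenPosMeasure_volume_pi_param {k : ℕ} {I : Type*} [Fintype I] :
    (volume : Measure (I → Param k)).IsOpenPosMeasure := by
  have : ∀ _ : I, (volume : Measure (Param k)).IsOpenPosMeasure := fun _ => inferInstance
  exact Measure.pi.isOpenPosMeasure _

variable {k : ℕ} {I : Type*} [Fintype I] {Θ : Set (Param k)} {ℓ : I → Param k → ℝ≥0∞}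

theorem continuousOn_prod_eval (hcont : ∀ i, ContinuousOn (ℓ i) Θ)
    (htop : ∀ i, ∀ x ∈ Θ, ℓ i x ≠ ∞) :
    ContinuousOn (fun θ : I → Param k => ∏ i, ℓ i (θ i)) (paramSpace I Θ) :=
  continuousOn_ennreal_prod
    (fun i _ => (hcont i).comp (continuous_apply i).continuousOn fun _ hθ => hθ i (mem_univ i))
    fun i _ _ hθ => htop i _ (hθ i (mem_univ i))

theorem aemeasurable_prod_eval (hΘ : IsCompact Θ) (hcont : ∀ i, ContinuousOn (ℓ i) Θ)
    (htop : ∀ i, ∀ x ∈ Θ, ℓ i x ≠ ∞) {S : Set (I → Param k)} (hS : S ⊆ paramSpace I Θ) :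
    AEMeasurable (fun θ : I → Param k => ∏ i, ℓ i (θ i)) (volume.restrict S) :=
  ((continuousOn_prod_eval hcont htop).aemeasurable
    (isCompact_paramSpace hΘ).measurableSet).mono_set hS

theorem setLIntegral_prod_eval_lt_top (hΘ : IsCompact Θ) (hcont : ∀ i, ContinuousOn (ℓ i) Θ)
    (htop : ∀ i, ∀ x ∈ Θ, ℓ i x ≠ ∞) :
    ∫⁻ θ in paramSpace I Θ, ∏ i, ℓ i (θ i) < ∞ :=
  setLIntegral_lt_top_of_continuousOn (isCompact_paramSpace hΘ)
    (continuousOn_prod_eval hcont htop) fun _ hθ =>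
      ENNReal.prod_ne_top fun i _ => htop i _ (hθ i (mem_univ i))

theorem setLIntegral_prod_eval_ne_zero (hΘ : IsCompact Θ) (hcont : ∀ i, ContinuousOn (ℓ i) Θ)
    (htop : ∀ i, ∀ x ∈ Θ, ℓ i x ≠ ∞) (h0 : ∀ i, ∀ x ∈ Θ, ℓ i x ≠ 0) {S : Set (I → Param k)}
    (hS : IsAdmissibleOpen (paramSpace I Θ) S) : ∫⁻ θ in S, ∏ i, ℓ i (θ i) ≠ 0 := by
  refine setLIntegral_ne_zero (hS.measurableSet (isCompact_paramSpace hΘ).measurableSet) ?_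
    (aemeasurable_prod_eval hΘ hcont htop hS.subset) fun θ hθ =>
      Finset.prod_ne_zero_iff.2 fun i _ => h0 i _ (hS.subset hθ i (mem_univ i))
  obtain ⟨x, hx⟩ := hS.nonempty
  have := hS.measure_inter_pos (μ := volume) hx isOpen_univ (mem_univ x)
  rw [inter_univ] at this
  exact this.ne'

theorem setLIntegral_paramSpace_ne_zero (hΘ : IsCompact Θ) (hcont : ∀ i, ContinuousOn (ℓ i) Θ)
    (htop : ∀ i, ∀ x ∈ Θ, ℓ i x ≠ ∞) (h0 : ∀ i, ∀ x ∈ Θ, ℓ i x ≠ 0)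
    (hne : (interior (paramSpace I Θ)).Nonempty) :
    ∫⁻ θ in paramSpace I Θ, ∏ i, ℓ i (θ i) ≠ 0 := fun h =>
  setLIntegral_prod_eval_ne_zero hΘ hcont htop h0 (isAdmissibleOpen_interior hne)
    (le_antisymm ((lintegral_mono_set interior_subset).trans h.le) zero_le)

/-- Laplace's principle for product likelihoods. The factors behave like `exp (-w T i * K i)`, up to
errors that are small relative to the weights `w T i` or bounded; the weights themselves
may have any behaviour, as long as their sum diverges. -/
theorem tendsto_log_setLIntegral_prod_div (hΘ : IsCompact Θ) {θ₀ : I → Param k}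
    (hθ₀ : θ₀ ∈ interior (paramSpace I Θ)) {K : I → Param k → ℝ}
    (hKc : ∀ i, ContinuousOn (K i) Θ) (hK : ∀ i, ∀ x ∈ Θ, 0 ≤ K i x) (hK₀ : ∀ i, K i (θ₀ i) = 0)
    {w : ℕ → I → ℝ} (hw : ∀ T i, 0 ≤ w T i) (hM : Tendsto (fun T => ∑ i, w T i) atTop atTop)
    {f : ℕ → I → Param k → ℝ≥0∞} {a : ℕ → I → ℝ≥0∞} {L : ℕ → I → Param k → ℝ}
    (ha : ∀ T i, a T i ≠ 0) (ha' : ∀ T i, a T i ≠ ∞)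
    (hf : ∀ T i, ∀ x ∈ Θ, f T i x = a T i * ENNReal.ofReal (Real.exp (-L T i x)))
    (hL : ∀ i, ∀ ε > 0, ∃ C, ∀ᶠ T in atTop, ∀ x ∈ Θ,
      |L T i x - w T i * K i x| ≤ ε * w T i + C)
    {S : Set (I → Param k)} (hS : IsAdmissibleOpen (paramSpace I Θ) S) :
    Tendsto (fun T => -(1 / ∑ i, w T i) *
        Real.log ((∫⁻ θ in S, ∏ i, f T i (θ i)) /
          ∫⁻ θ in paramSpace I Θ, ∏ i, f T i (θ i)).toReal -
        sInf ((fun θ => ∑ i, (w T i / ∑ j, w T j) * K i (θ i)) '' S))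
      atTop (𝓝 0) := by
  have hM0 : ∀ T, 0 ≤ ∑ i, w T i := fun T => Finset.sum_nonneg fun i _ => hw T i
  have hmem : ∀ θ ∈ paramSpace I Θ, ∀ i, θ i ∈ Θ := fun θ hθ i => hθ i (mem_univ i)
  have H : LaplaceData (paramSpace I Θ)
      (fun T θ => ∑ i, (w T i / ∑ j, w T j) * K i (θ i)) (fun T => ∑ i, w T i)
      (fun T θ => ∏ i, f T i (θ i)) (fun T => ∏ i, a T i) (fun T θ => ∑ i, L T i (θ i)) :=
    { compact := isCompact_paramSpace hΘ
      rate_nonneg := fun T θ hθ => Finset.sum_nonneg fun i _ =>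
        mul_nonneg (div_nonneg (hw T i) (hM0 T)) (hK i _ (hmem θ hθ i))
      equicontinuous := by
        intro ε hε
        have hc : ContinuousOn (fun (θ : I → Param k) i => K i (θ i)) (paramSpace I Θ) :=
          continuousOn_pi.2 fun i => (hKc i).comp (continuous_apply i).continuousOn
            fun θ hθ => hmem θ hθ i
        obtain ⟨δ, hδ, h⟩ := Metric.uniformContinuousOn_iff.1
          ((isCompact_paramSpace hΘ).uniformContinuousOn_of_continuous hc) ε hε
        refine ⟨δ, hδ, fun T θ hθ θ' hθ' hd => ?_⟩
        have hi : ∀ i, |K i (θ i) - K i (θ' i)| ≤ ε := fun i => by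
          rw [← Real.dist_eq]
          exact (dist_le_pi_dist (fun i => K i (θ i)) (fun i => K i (θ' i)) i).trans
            (h θ hθ θ' hθ' hd).le
        rw [← Finset.sum_sub_distrib]
        calc |∑ i, ((w T i / ∑ j, w T j) * K i (θ i) - (w T i / ∑ j, w T j) * K i (θ' i))|
            ≤ ∑ i, (w T i / ∑ j, w T j) * ε := by
              refine (Finset.abs_sum_le_sum_abs _ _).trans (Finset.sum_le_sum fun i _ => ?_)
              rw [← mul_sub, abs_mul, abs_of_nonneg (div_nonneg (hw T i) (hM0 T))]
              exact mul_le_mul_of_nonneg_left (hi i) (div_nonneg (hw T i) (hM0 T))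
          _ ≤ ε := by
              rw [← Finset.sum_mul, ← Finset.sum_div]
              exact mul_le_of_le_one_left hε.le (div_self_le_one _)
      tendsto_speed := hM
      const_ne_zero := fun T => Finset.prod_ne_zero_iff.2 fun i _ => ha T i
      const_ne_top := fun T => ENNReal.prod_ne_top fun i _ => ha' T i
      eq_exp := by
        intro T θ hθ
        rw [← Finset.sum_neg_distrib, Real.exp_sum,
          ENNReal.ofReal_prod_of_nonneg fun _ _ => (Real.exp_pos _).le, ← Finset.prod_mul_distrib]
        exact Finset.prod_congr rfl fun i _ => hf T i _ (hmem θ hθ i)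
      approx := by
        intro ε hε
        choose C hC using fun i => hL i (ε / 2) (half_pos hε)
        filter_upwards [eventually_all.2 hC, hM.eventually_gt_atTop 0,
          hM.eventually_ge_atTop ((∑ i, C i) / (ε / 2))] with T hT hpos hlarge θ hθ
        rw [div_le_iff₀ (half_pos hε)] at hlarge
        have e : (∑ i, w T i) * ∑ i, (w T i / ∑ j, w T j) * K i (θ i) =
            ∑ i, w T i * K i (θ i) := by
          rw [Finset.mul_sum]
          refine Finset.sum_congr rfl fun i _ => ?_
          field_simp
        rw [e, ← Finset.sum_sub_distrib]
        calc |∑ i, (L T i (θ i) - w T i * K i (θ i))| ≤ ∑ i, (ε / 2 * w T i + C i) :=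
              (Finset.abs_sum_le_sum_abs _ _).trans
                (Finset.sum_le_sum fun i _ => hT i _ (hmem θ hθ i))
          _ = ε / 2 * ∑ i, w T i + ∑ i, C i := by
              rw [Finset.sum_add_distrib, ← Finset.mul_sum]
          _ ≤ ε * ∑ i, w T i := by linarith }
  exact H.tendsto_log_div hS hθ₀ fun T => Finset.sum_eq_zero fun i _ => by rw [hK₀, mul_zero]

end ProductIntegral

/-! ### Cylinders over one context -/

section Cylinder

variable {k : ℕ} {𝓓 𝓒 : Type*} {ctx : 𝓓 → 𝓒} {Θ : Set (Param k)} {c : 𝓒}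

theorem contextCylinder_paramSpace :
    contextCylinder ctx Θ c (paramSpace {d : 𝓓 // ctx d = c} Θ) = paramSpace 𝓓 Θ := by
  ext θ
  exact ⟨fun h => h.1, fun h => ⟨h, fun d _ => h d (mem_univ _)⟩⟩

theorem image_contextCylinder [DecidableEq 𝓒] {β : Type*} {S : Set ({d : 𝓓 // ctx d = c} → Param k)}
    (hS : S ⊆ paramSpace _ Θ) {θ₀ : 𝓓 → Param k} (hθ₀ : θ₀ ∈ paramSpace 𝓓 Θ)
    (g : ({d : 𝓓 // ctx d = c} → Param k) → β) :
    (fun θ : 𝓓 → Param k => g fun d => θ d) '' contextCylinder ctx Θ c S = g '' S := by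
  ext b
  constructor
  · rintro ⟨θ, hθ, rfl⟩
    exact ⟨_, hθ.2, rfl⟩
  · rintro ⟨θ, hθ, rfl⟩
    have e : (fun d : {d : 𝓓 // ctx d = c} =>
        (fun d' : 𝓓 => if h : ctx d' = c then θ ⟨d', h⟩ else θ₀ d') d) = θ := by
      funext d
      simp [d.2]
    refine ⟨fun d => if h : ctx d = c then θ ⟨d, h⟩ else θ₀ d, ⟨fun d _ => ?_, ?_⟩, ?_⟩
    · by_cases h : ctx d = c
      · simpa [h] using hS hθ ⟨d, h⟩ (mem_univ _)
      · simpa [h] using hθ₀ d (mem_univ _)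
    · rw [e]; exact hθ
    · exact congrArg g e

/-- The integral of a product over a cylinder factorizes into the integrals over the designs of the
context and over the other designs. -/
theorem setLIntegral_contextCylinder [Fintype 𝓓] [DecidableEq 𝓒] (hΘ : IsCompact Θ)
    {ℓ : 𝓓 → Param k → ℝ≥0∞} (hcont : ∀ d, ContinuousOn (ℓ d) Θ)
    (htop : ∀ d, ∀ x ∈ Θ, ℓ d x ≠ ∞) {S : Set ({d : 𝓓 // ctx d = c} → Param k)}
    (hS : S ⊆ paramSpace _ Θ) :
    ∫⁻ θ in contextCylinder ctx Θ c S, ∏ d, ℓ d (θ d) =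
      (∫⁻ θ in S, ∏ d : {d : 𝓓 // ctx d = c}, ℓ d (θ d)) *
        ∫⁻ θ in paramSpace {d : 𝓓 // ¬ctx d = c} Θ,
          ∏ d : {d : 𝓓 // ¬ctx d = c}, ℓ d (θ d) := by
  have hmp := volume_preserving_piEquivPiSubtypeProd (fun _ : 𝓓 => Param k) (fun d => ctx d = c)
  have hpre : contextCylinder ctx Θ c S =
      MeasurableEquiv.piEquivPiSubtypeProd (fun _ : 𝓓 => Param k) (fun d => ctx d = c) ⁻¹'
        (S ×ˢ paramSpace {d : 𝓓 // ¬ctx d = c} Θ) := by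
    ext θ
    constructor
    · exact fun h => ⟨h.2, fun d _ => h.1 d (mem_univ _)⟩
    · refine fun h => ⟨fun d _ => ?_, h.1⟩
      by_cases hd : ctx d = c
      · exact hS h.1 ⟨d, hd⟩ (mem_univ _)
      · exact h.2 ⟨d, hd⟩ (mem_univ _)
  rw [hpre, ← lintegral_prod_mul
    (aemeasurable_prod_eval (ℓ := fun d : {d : 𝓓 // ctx d = c} => ℓ d) hΘ (fun d => hcont d)
      (fun d => htop d) hS)
    (aemeasurable_prod_eval (ℓ := fun d : {d : 𝓓 // ¬ctx d = c} => ℓ d) hΘ (fun d => hcont d)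
      (fun d => htop d) subset_rfl), Measure.prod_restrict,
    ← Measure.volume_eq_prod, ← hmp.setLIntegral_comp_preimage_emb
      (MeasurableEquiv.measurableEmbedding _)]
  refine lintegral_congr fun θ => ?_
  exact (Fintype.prod_subtype_mul_prod_subtype (fun d => ctx d = c) fun d => ℓ d (θ d)).symm

end Cylinder

/-! ### The posterior distribution -/

section Posterior

variable {k : ℕ} {𝓓 Ω : Type*} [Fintype 𝓓] [DecidableEq 𝓓] {p : Param k → ℝ → ℝ}
  {Θ : Set (Param k)} {Y : ℕ → Ω → 𝓓 → ℝ} {A : ℕ → Ω → 𝓓}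

theorem posteriorMeasure_apply {T : ℕ} {ω : Ω} {S : Set (𝓓 → Param k)} (hSm : MeasurableSet S)
    (hS : S ⊆ paramSpace 𝓓 Θ) :
    posteriorMeasure p Θ Y A T ω S =
      (∫⁻ θ in S, ∏ d, designLikelihood p Y A T ω d (θ d)) /
        ∫⁻ θ in paramSpace 𝓓 Θ, ∏ d, designLikelihood p Y A T ω d (θ d) := by
  simp only [← likelihood_eq_prod]
  rw [posteriorMeasure, Measure.smul_apply, withDensity_apply _ hSm,
    Measure.restrict_restrict hSm, inter_eq_left.2 hS, smul_eq_mul, mul_comm, ENNReal.div_eq_inv_mul,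
    mul_comm]

theorem isProbabilityMeasure_posteriorMeasure {T : ℕ} {ω : Ω}
    (h0 : ∫⁻ θ in paramSpace 𝓓 Θ, ∏ d, designLikelihood p Y A T ω d (θ d) ≠ 0)
    (htop : ∫⁻ θ in paramSpace 𝓓 Θ, ∏ d, designLikelihood p Y A T ω d (θ d) ≠ ∞) :
    IsProbabilityMeasure (posteriorMeasure p Θ Y A T ω) := by
  simp only [← likelihood_eq_prod] at h0 htop
  refine ⟨?_⟩
  rw [posteriorMeasure, Measure.smul_apply, withDensity_apply _ MeasurableSet.univ,
    Measure.restrict_univ, smul_eq_mul, ENNReal.inv_mul_cancel h0 htop]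

end Posterior

end ContextualSelection

theorem theorem1 {k : ℕ} {𝓓 𝓒 Ω : Type*}
    [Fintype 𝓓] [DecidableEq 𝓓] [MeasurableSpace 𝓓] [MeasurableSingletonClass 𝓓]
    [DecidableEq 𝓒] [MeasurableSpace Ω] (P : Measure Ω) [IsProbabilityMeasure P]
    (ctx : 𝓓 → 𝓒)
    (ν : Measure ℝ) (p : Param k → ℝ → ℝ) (Θ : Set (Param k))
    (hreg : IsRegularFamily ν p Θ)
    (θstar : 𝓓 → Param k) (hθstar : θstar ∈ interior (paramSpace 𝓓 Θ))
    (hKL : ∀ d, ContDiffOn ℝ 1 (fun θ => KL ν p (θstar d) θ) Θ)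
    (Y : ℕ → Ω → 𝓓 → ℝ) (A : ℕ → Ω → 𝓓) (ψ : ℕ → 𝓓 → Ω → ℝ)
    (hψ : IsSequentialSampling P ν p θstar Y A ψ) :
    (∀ S : Set (𝓓 → Param k), IsAdmissibleOpen (paramSpace 𝓓 Θ) S →
      ∀ᵐ ω ∂P,
        (∀ T : ℕ, IsProbabilityMeasure (posteriorMeasure p Θ Y A T ω) ∧
          0 < posteriorMeasure p Θ Y A T ω S) ∧
        Tendsto
          (fun T : ℕ =>
            -(1 / (T : ℝ)) * Real.log ((posteriorMeasure p Θ Y A T ω).real S)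
              - sInf ((fun θ => weightedKL ν p Finset.univ (fun d => psiBar ψ T d ω) θstar θ) '' S))
          atTop (𝓝 0)) ∧
    (∀ (c : 𝓒) (Sc : Set ({d : 𝓓 // ctx d = c} → Param k)),
      IsAdmissibleOpen (paramSpace {d : 𝓓 // ctx d = c} Θ) Sc →
      ∀ᵐ ω ∂P,
        Tendsto (fun T : ℕ => (T : ℝ) * alphaBar ctx ψ T c ω) atTop atTop →
        (∀ T : ℕ, 0 < posteriorMeasure p Θ Y A T ω (contextCylinder ctx Θ c Sc)) ∧
        Tendsto
          (fun T : ℕ =>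
            -(1 / ((T : ℝ) * alphaBar ctx ψ T c ω)) *
                Real.log ((posteriorMeasure p Θ Y A T ω).real (contextCylinder ctx Θ c Sc))
              - sInf ((fun θ => weightedKL ν p (Finset.univ.filter (fun d => ctx d = c))
                    (fun d => betaBar ctx ψ T c d ω) θstar θ) '' contextCylinder ctx Θ c Sc))
          atTop (𝓝 0)) := by
  have hθ : ∀ d, θstar d ∈ Θ := fun d => interior_subset hθstar d (mem_univ d)
  have hKLc : ∀ d, ContinuousOn (KL ν p (θstar d)) Θ := fun d => (hKL d).continuousOn
  have hKL0 : ∀ d, ∀ x ∈ Θ, 0 ≤ KL ν p (θstar d) x := fun d x hx =>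
    hreg.density.KL_nonneg (hθ d) hx ((hreg.glivenkoCantelli _ (hθ d)).1 _ (hθ d) _ hx)
  have hcont : ∀ T ω d, ContinuousOn (designLikelihood p Y A T ω d) Θ := fun T ω d =>
    continuousOn_designLikelihood hreg.continuous T
  have htop : ∀ T ω d, ∀ x ∈ Θ, designLikelihood p Y A T ω d x ≠ ∞ := fun T ω d x _ =>
    designLikelihood_ne_top T ω d x
  have hw : ∀ ω (T : ℕ) d, 0 ≤ ∑ t ∈ Finset.range T, ψ t d ω := fun ω T d =>
    Finset.sum_nonneg fun t _ => hψ.nonneg t d ω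
  have hint : ∀ d, θstar d ∈ interior Θ := by
    intro d
    have h := hθstar
    rw [paramSpace, interior_pi_set finite_univ] at h
    exact h d (mem_univ d)
  have hB := isCompact_paramSpace (I := 𝓓) hreg.compact
  refine ⟨fun S hS => ?_, fun c Sc hSc => ?_⟩
  · filter_upwards [hψ.ae_pos hreg hθ, hψ.ae_abs_designLogLR_sub_le hreg hθ hKLc] with ω hpos hlim
    have h0 : ∀ T d, ∀ x ∈ Θ, designLikelihood p Y A T ω d x ≠ 0 := fun T d x hx =>
      designLikelihood_ne_zero (hpos d) T hx
    have hSm := hS.measurableSet hB.measurableSet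
    have hZ0 : ∀ T, ∫⁻ θ in paramSpace 𝓓 Θ, ∏ d, designLikelihood p Y A T ω d (θ d) ≠ 0 :=
      fun T => setLIntegral_paramSpace_ne_zero hreg.compact (hcont T ω) (htop T ω) (h0 T)
        ⟨θstar, hθstar⟩
    have hZ : ∀ T, ∫⁻ θ in paramSpace 𝓓 Θ, ∏ d, designLikelihood p Y A T ω d (θ d) ≠ ∞ :=
      fun T => (setLIntegral_prod_eval_lt_top hreg.compact (hcont T ω) (htop T ω)).ne
    refine ⟨fun T => ⟨isProbabilityMeasure_posteriorMeasure (hZ0 T) (hZ T), ?_⟩, ?_⟩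
    · rw [posteriorMeasure_apply hSm hS.subset]
      exact ENNReal.div_pos (setLIntegral_prod_eval_ne_zero hreg.compact (hcont T ω) (htop T ω)
        (h0 T) hS) (hZ T)
    · have hsum : ∀ T : ℕ, ∑ d, ∑ t ∈ Finset.range T, ψ t d ω = T := by
        intro T
        rw [Finset.sum_comm]
        simp [hψ.sum_eq_one]
      have h := tendsto_log_setLIntegral_prod_div hreg.compact hθstar hKLc hKL0
        (fun d => KL_self ν p (θstar d)) (hw ω)
        (by simpa only [hsum] using tendsto_natCast_atTop_atTop)
        (fun T d => h0 T d _ (hθ d)) (fun T d => htop T ω d _ (hθ d))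
        (fun T d x hx => designLikelihood_eq_exp (hpos d) T (hθ d) hx) hlim hS
      simp only [hsum] at h
      simpa only [measureReal_def, posteriorMeasure_apply hSm hS.subset, weightedKL, psiBar] using h
  · filter_upwards [hψ.ae_pos hreg hθ, hψ.ae_abs_designLogLR_sub_le hreg hθ hKLc]
      with ω hpos hlim hα
    have h0 : ∀ T d, ∀ x ∈ Θ, designLikelihood p Y A T ω d x ≠ 0 := fun T d x hx =>
      designLikelihood_ne_zero (hpos d) T hx
    have hθI : ∀ q : 𝓓 → Prop, (fun d : {d : 𝓓 // q d} => θstar d) ∈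
        interior (paramSpace {d : 𝓓 // q d} Θ) := by
      intro q
      rw [paramSpace, interior_pi_set finite_univ]
      exact fun d _ => hint d
    have hBc := isCompact_paramSpace (I := {d : 𝓓 // ctx d = c}) hreg.compact
    have hcylm : MeasurableSet (contextCylinder ctx Θ c Sc) := by
      refine hB.measurableSet.inter ?_
      exact (measurable_pi_lambda _ fun d => measurable_pi_apply d.1)
        (hSc.measurableSet hBc.measurableSet)
    have hpost : ∀ T, posteriorMeasure p Θ Y A T ω (contextCylinder ctx Θ c Sc) =
        (∫⁻ θ in Sc, ∏ d : {d : 𝓓 // ctx d = c}, designLikelihood p Y A T ω d (θ d)) /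
          ∫⁻ θ in paramSpace {d : 𝓓 // ctx d = c} Θ,
            ∏ d : {d : 𝓓 // ctx d = c}, designLikelihood p Y A T ω d (θ d) := by
      intro T
      rw [posteriorMeasure_apply hcylm fun θ h => h.1,
        setLIntegral_contextCylinder hreg.compact (hcont T ω) (htop T ω) hSc.subset,
        ← contextCylinder_paramSpace (ctx := ctx) (c := c),
        setLIntegral_contextCylinder hreg.compact (hcont T ω) (htop T ω) subset_rfl]
      refine ENNReal.mul_div_mul_right _ _ ?_ ?_
      · exact setLIntegral_paramSpace_ne_zero hreg.compact (ℓ := fun d : {d : 𝓓 // ¬ctx d = c} => designLikelihood p Y A T ω d)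
          (fun d => hcont T ω d)
          (fun d => htop T ω d) (fun d => h0 T d) ⟨_, hθI _⟩
      · exact (setLIntegral_prod_eval_lt_top hreg.compact (ℓ := fun d : {d : 𝓓 // ¬ctx d = c} => designLikelihood p Y A T ω d)
          (fun d => hcont T ω d)
          (fun d => htop T ω d)).ne
    refine ⟨fun T => ?_, ?_⟩
    · rw [hpost]
      exact ENNReal.div_pos (setLIntegral_prod_eval_ne_zero hreg.compact (ℓ := fun d : {d : 𝓓 // ctx d = c} => designLikelihood p Y A T ω d)
          (fun d => hcont T ω d)
        (fun d => htop T ω d) (fun d => h0 T d) hSc)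
        (setLIntegral_prod_eval_lt_top hreg.compact (ℓ := fun d : {d : 𝓓 // ctx d = c} => designLikelihood p Y A T ω d)
          (fun d => hcont T ω d)
          (fun d => htop T ω d)).ne
    · have hsub : ∀ g : 𝓓 → ℝ, ∑ d with ctx d = c, g d = ∑ d : {d : 𝓓 // ctx d = c}, g d :=
        fun g => Finset.sum_subtype _ (by simp) g
      have hαT : ∀ T : ℕ, alphaBar ctx ψ T c ω =
          (∑ d : {d : 𝓓 // ctx d = c}, ∑ t ∈ Finset.range T, ψ t d ω) / T := by
        intro T
        rw [alphaBar, hsub, Finset.sum_div]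
        rfl
      -- for `T = 0`, both sides vanish
      have hTα : ∀ T : ℕ, (T : ℝ) * alphaBar ctx ψ T c ω =
          ∑ d : {d : 𝓓 // ctx d = c}, ∑ t ∈ Finset.range T, ψ t d ω := by
        intro T
        rcases eq_or_ne T 0 with rfl | hT
        · simp
        · rw [hαT, mul_div_cancel₀ _ (Nat.cast_ne_zero.2 hT)]
      -- for `T = 0`, both sides are quotients `0 / 0`
      have hβ : ∀ T d, betaBar ctx ψ T c d ω = (∑ t ∈ Finset.range T, ψ t d ω) /
          ∑ d : {d : 𝓓 // ctx d = c}, ∑ t ∈ Finset.range T, ψ t d ω := by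
        intro T d
        rcases eq_or_ne T 0 with rfl | hT
        · simp [betaBar, psiBar]
        · rw [betaBar, hαT, psiBar, div_div_div_cancel_right₀ (Nat.cast_ne_zero.2 hT)]
      simp only [hTα] at hα
      have h := tendsto_log_setLIntegral_prod_div (I := {d : 𝓓 // ctx d = c}) hreg.compact
        (hθI _) (fun d => hKLc d) (fun d => hKL0 d)
        (fun d => KL_self ν p (θstar d)) (fun T d => hw ω T d) hα
        (fun T d => h0 T d _ (hθ d)) (fun T d => htop T ω d _ (hθ d))
        (fun T d x hx => designLikelihood_eq_exp (hpos d) T (hθ d) hx) (fun d => hlim d) hSc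
      refine h.congr fun T => ?_
      rw [measureReal_def, hpost, hTα]
      congr 2
      rw [← image_contextCylinder hSc.subset (interior_subset hθstar)]
      refine image_congr fun θ _ => ?_
      rw [weightedKL, hsub]
      exact Finset.sum_congr rfl fun d _ => by rw [hβ]
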